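/- Let $q$ be a prime power, let $m,n,r$ be positive integers with $m \mid rn$, and write $[i]=q^i$. For $s\ge 0$ let $\theta_s$ raise every coordinate of a vector in $\mathbb{F}_{q^m}^n$ (respectively every coefficient of a polynomial over $\mathbb{F}_{q^m}$) to the power $q^s$. Let $C\subseteq \mathbb{F}_{q^m}^n$ be an $\mathbb{F}_{q^m}$-linear $q^r$-cyclic code, i.e. $(c_{n-1}^{[r]},c_0^{[r]},\dots,c_{n-2}^{[r]})\in C$ for all $(c_0,\dots,c_{n-1})\in C$. Put $C^{[i]}=\theta_i(C)$, $C^*=\sum_{i=0}^{m-1}C^{[i]}$ and $C^0=\bigcap_{i=0}^{m-1}C^{[i]}$. Consider the ring of $q^r$-linearized polynomials $F(x)=F_0x+F_1x^{[r]}+\cdots+F_dx^{[dr]}$ over $\mathbb{F}_{q^m}$, with composition $\otimes$ as product. Divisibility, (monic) $\gcd$ and (monic) $\mathrm{lcm}$ are taken on the right: $D$ divides $F$ if $F=P\otimes D$ for some linearized $P$. For $F$ with $F_0\ne0$, $F_d\neq 0$ and $d\le n$ put $$F^\perp(x)=\sum_{i=0}^d \frac{F_{d-i}^{[ir]}}{F_0^{[dr]}}\,x^{[ir]},\qquad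 F^\top(x)=\sum_{i=0}^d\Big(\frac{F_{d-i}}{F_0}\Big)^{[(n-d+i)r]}x^{[ir]},$$ $$F^*=\gcd(F,\theta_1(F),\dots,\theta_{m-1}(F)),\qquad F^0=\mathrm{lcm}(F,\theta_1(F),\dots,\theta_{m-1}(F)),$$ $$F_*=\gcd(F^\perp,\theta_1(F)^\perp,\dots,\theta_{m-1}(F)^\perp)^\top,\qquad F_0=\mathrm{lcm}(F^\perp,\theta_1(F)^\perp,\dots,\theta_{m-1}(F)^\perp)^\top$$ (the polynomial $F_0$ is not to be confused with the coefficient $F_0$). The generator polynomial $G$ and check polynomial $H$ of a linear $q^r$-cyclic code $D\subseteq\mathbb{F}_{q^m}^n$ are defined as follows: $G$ is monic and of minimal degree among the nonzero $q^r$-linearized polynomials congruent modulo $x^{[rn]}-x$ to $c_0x+c_1x^{[r]}+\cdots+c_{n-1}x^{[(n-1)r]}$ for some $(c_0,\dots,c_{n-1})\in D$, and $H$ is $q^r$-linearized with $x^{[rn]}-x=G\otimes H=H\otimes G$. The conventional generator and check polynomials $g,h$ of a linear cyclic code $D$ are defined likewise: $g$ is monic and of minimal degree among the nonzero polynomials congruent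 modulo $x^n-1$ to $c_0+c_1x+\cdots+c_{n-1}x^{n-1}$ for some $(c_0,\dots,c_{n-1})\in D$, and $gh=x^n-1$. Let $L(f_0+f_1x+\cdots+f_dx^d)=f_0x+f_1x^{[r]}+\cdots+f_dx^{[dr]}$. Then $C$ has unique generator and check polynomials $G,H$. The codes $C^*$ and $C^0$ are both cyclic and $q^r$-cyclic. As $q^r$-cyclic codes, $C^*$ has generator polynomial $G^*$ and check polynomial $H_0$, and $C^0$ has generator polynomial $G^0$ and check polynomial $H_*$. As cyclic codes, $C^*$ has unique conventional generator and check polynomials, denoted $g^*,h^0$, and $C^0$ has unique conventional generator and check polynomials, denoted $g^0,h^*$; and $$G^*=L(g^*),\qquad H_0=L(h^0),\qquad G^0=L(g^0),\qquad H_*=L(h^*).$$ -/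

import Mathlib

open Polynomial

noncomputable section

namespace SkewCyclic

section Codes

variable (Fq : Type*) {K : Type*} [Field Fq] [Fintype Fq] [Field K] [Finite K] [Algebra Fq K]

/-- The `s`-th Frobenius map `a ↦ a ^ (q ^ s)` of the field `K` with `q ^ m` elements, where `q` is
the number of elements of the subfield `Fq` and `m` is the degree of `K` over `Fq`. -/
def frob (s : ℕ) : K →+* K where
  toFun a := a ^ (Fintype.card Fq ^ s)
  map_one' := one_pow _
  map_mul' a b := mul_pow a b _
  map_zero' := zero_pow (pow_ne_zero _ Fintype.card_ne_zero)
  map_add' a b := by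
    have h : ∀ x : K, x ^ (Fintype.card Fq ^ s) = (FiniteField.frobeniusAlgHom Fq K ^ s) x := by
      intro x
      induction s with
      | zero => simp
      | succ k ih =>
        rw [pow_succ, pow_mul, ih, pow_succ', AlgHom.mul_apply,
          FiniteField.frobeniusAlgHom_apply]
    simp only [h, map_add]

theorem frob_surjective (s : ℕ) : Function.Surjective (frob Fq s : K →+* K) :=
  Finite.surjective_of_injective (frob Fq s : K →+* K).injective

variable {n : ℕ}

/-- `θ_s` on vectors: raise every coordinate to the power `q ^ s`. -/
def frobVec (s : ℕ) (c : Fin n → K) : Fin n → K := fun i => c i ^ (Fintype.card Fq ^ s)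

/-- The shifting operator `(c_0, …, c_{n-1}) ↦ (c_{n-1}, c_0, …, c_{n-2})`
(subtraction in `Fin n` is modulo `n`). -/
def shift {K : Type*} [NeZero n] (c : Fin n → K) : Fin n → K := fun i => c (i - 1)

/-- A linear code is cyclic if it is stable under the shifting operator. -/
def IsCyclicCode [NeZero n] (C : Submodule K (Fin n → K)) : Prop :=
  ∀ c ∈ C, shift c ∈ C

/-- A linear code is `q ^ r`-cyclic if it is stable under the `q ^ r`-shifting operator
`θ_r ∘ shift`. -/
def IsSkewCyclic [NeZero n] (r : ℕ) (C : Submodule K (Fin n → K)) : Prop :=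
  ∀ c ∈ C, frobVec Fq r (shift c) ∈ C

/-- The code `C^{[s]} = θ_s(C)`. -/
def frobCode (s : ℕ) (C : Submodule K (Fin n → K)) : Submodule K (Fin n → K) where
  carrier := frobVec Fq s '' (C : Set (Fin n → K))
  zero_mem' := ⟨0, C.zero_mem, funext fun _ => map_zero (frob Fq s : K →+* K)⟩
  add_mem' := by
    rintro _ _ ⟨a, ha, rfl⟩ ⟨b, hb, rfl⟩
    exact ⟨a + b, C.add_mem ha hb, funext fun i => map_add (frob Fq s) (a i) (b i)⟩
  smul_mem' := by
    rintro t _ ⟨a, ha, rfl⟩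
    obtain ⟨u, rfl⟩ := frob_surjective Fq s t
    exact ⟨u • a, C.smul_mem u ha, funext fun i => map_mul (frob Fq s) u (a i)⟩

/-- The Galois closure `C^* = ∑_{i=0}^{m-1} C^{[i]}`, with `m = [K : Fq]`. -/
def galoisClosure (C : Submodule K (Fin n → K)) : Submodule K (Fin n → K) :=
  ⨆ i : Fin (Module.finrank Fq K), frobCode Fq i C

/-- The Galois interior `C^0 = ⋂_{i=0}^{m-1} C^{[i]}`, with `m = [K : Fq]`. -/
def galoisInterior (C : Submodule K (Fin n → K)) : Submodule K (Fin n → K) :=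
  ⨅ i : Fin (Module.finrank Fq K), frobCode Fq i C

end Codes

section Conventional

variable {K : Type*} [Field K] {n : ℕ}

/-- The residue class of `f` modulo `x ^ n - 1` lies in `C(x)`, that is, it is the class of
`c_0 + c_1 x + ⋯ + c_{n-1} x ^ (n-1)` for some codeword `c`. -/
def InIdeal (C : Submodule K (Fin n → K)) (f : K[X]) : Prop :=
  ∃ c ∈ C, ∃ p : K[X],
    f = ∑ i : Fin n, Polynomial.C (c i) * X ^ (i : ℕ) + p * (X ^ n - 1)

/-- `g` and `h` are the generator and check polynomials of the linear cyclic code `C`: `g` is monic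
and of minimal degree among the nonzero polynomials whose class lies in `C(x)`, and
`g h = x ^ n - 1`. -/
structure IsGenCheck [NeZero n] (C : Submodule K (Fin n → K)) (g h : K[X]) : Prop where
  cyclic : IsCyclicCode C
  monic : g.Monic
  mem : InIdeal C g
  minimal : ∀ f : K[X], InIdeal C f → f ≠ 0 → g.natDegree ≤ f.natDegree
  mul_eq : g * h = X ^ n - 1

end Conventional

section Linearized

variable {K : Type*} [Field K]

/-- `F` is a `Q`-linearized polynomial `F_0 x + F_1 x ^ Q + ⋯ + F_d x ^ (Q ^ d)`. The product of
the ring of linearized polynomials is the composition `Polynomial.comp`. -/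
def IsLinearized (Q : ℕ) (F : K[X]) : Prop :=
  ∀ k : ℕ, F.coeff k ≠ 0 → ∃ i : ℕ, k = Q ^ i

/-- `D` divides `F` on the right in the ring of `Q`-linearized polynomials: `F = P ⊗ D`. -/
def RightDvd (Q : ℕ) (D F : K[X]) : Prop :=
  ∃ P : K[X], IsLinearized Q P ∧ F = P.comp D

/-- `D` is the (monic) greatest common right divisor of the family `S`. -/
structure IsRightGcd (Q : ℕ) {ι : Type*} (S : ι → K[X]) (D : K[X]) : Prop where
  linearized : IsLinearized Q D
  monic : D.Monic
  dvd : ∀ i, RightDvd Q D (S i)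
  greatest : ∀ E : K[X], IsLinearized Q E → (∀ i, RightDvd Q E (S i)) → RightDvd Q E D

/-- `M` is the (monic) least common multiple of the family `S` for divisibility on the right. -/
structure IsRightLcm (Q : ℕ) {ι : Type*} (S : ι → K[X]) (M : K[X]) : Prop where
  linearized : IsLinearized Q M
  monic : M.Monic
  dvd : ∀ i, RightDvd Q (S i) M
  least : ∀ E : K[X], IsLinearized Q E → (∀ i, RightDvd Q (S i) E) → RightDvd Q M E

open Classical in
/-- The monic greatest common right divisor of a family (`0` if there is none). -/
def rightGcd (Q : ℕ) {ι : Type*} (S : ι → K[X]) : K[X] :=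
  if h : ∃ D, IsRightGcd Q S D then h.choose else 0

open Classical in
/-- The monic least common multiple of a family, on the right (`0` if there is none). -/
def rightLcm (Q : ℕ) {ι : Type*} (S : ι → K[X]) : K[X] :=
  if h : ∃ M, IsRightLcm Q S M then h.choose else 0

/-- The `Q`-degree: `d` for a linearized polynomial `F_0 x + ⋯ + F_d x ^ (Q ^ d)`, `F_d ≠ 0`. -/
def linDegree (Q : ℕ) (F : K[X]) : ℕ := Nat.log Q F.natDegree

/-- The coefficient `F_i` of `x ^ (Q ^ i)`. -/
def linCoeff (Q : ℕ) (F : K[X]) (i : ℕ) : K := F.coeff (Q ^ i)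

/-- `F^⊥ = ∑_{i=0}^{d} (F_{d-i} ^ (Q ^ i) / F_0 ^ (Q ^ d)) x ^ (Q ^ i)`. -/
def linPerp (Q : ℕ) (F : K[X]) : K[X] :=
  ∑ i ∈ Finset.range (linDegree Q F + 1),
    Polynomial.C (linCoeff Q F (linDegree Q F - i) ^ (Q ^ i) /
      linCoeff Q F 0 ^ (Q ^ linDegree Q F)) * X ^ (Q ^ i)

/-- `F^⊤ = ∑_{i=0}^{d} (F_{d-i} / F_0) ^ (Q ^ (n-d+i)) x ^ (Q ^ i)`, for `F` dividing
`x ^ (Q ^ n) - x` (so that `d ≤ n`). -/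
def linTop (Q n : ℕ) (F : K[X]) : K[X] :=
  ∑ i ∈ Finset.range (linDegree Q F + 1),
    Polynomial.C ((linCoeff Q F (linDegree Q F - i) / linCoeff Q F 0) ^
      (Q ^ (n - linDegree Q F + i))) * X ^ (Q ^ i)

/-- The map `L(f_0 + f_1 x + ⋯ + f_d x ^ d) = f_0 x + f_1 x ^ Q + ⋯ + f_d x ^ (Q ^ d)`. -/
def linearize (Q : ℕ) (f : K[X]) : K[X] :=
  f.sum fun i a => Polynomial.C a * X ^ (Q ^ i)

end Linearized

section SkewGenerators

variable (Fq : Type*) {K : Type*} [Field Fq] [Fintype Fq] [Field K] [Finite K] [Algebra Fq K]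

/-- `F^* = gcd(F, θ_1(F), …, θ_{m-1}(F))`, in the ring of `q ^ r`-linearized polynomials. -/
def upperStar (r : ℕ) (F : K[X]) : K[X] :=
  rightGcd (Fintype.card Fq ^ r)
    fun i : Fin (Module.finrank Fq K) => F.map (frob Fq i)

/-- `F^0 = lcm(F, θ_1(F), …, θ_{m-1}(F))`, in the ring of `q ^ r`-linearized polynomials. -/
def upperZero (r : ℕ) (F : K[X]) : K[X] :=
  rightLcm (Fintype.card Fq ^ r)
    fun i : Fin (Module.finrank Fq K) => F.map (frob Fq i)

/-- `F_* = gcd(F^⊥, θ_1(F)^⊥, …, θ_{m-1}(F)^⊥)^⊤`. -/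
def lowerStar (r n : ℕ) (F : K[X]) : K[X] :=
  linTop (Fintype.card Fq ^ r) n <| rightGcd (Fintype.card Fq ^ r)
    fun i : Fin (Module.finrank Fq K) => linPerp (Fintype.card Fq ^ r) (F.map (frob Fq i))

/-- `F_0 = lcm(F^⊥, θ_1(F)^⊥, …, θ_{m-1}(F)^⊥)^⊤`. -/
def lowerZero (r n : ℕ) (F : K[X]) : K[X] :=
  linTop (Fintype.card Fq ^ r) n <| rightLcm (Fintype.card Fq ^ r)
    fun i : Fin (Module.finrank Fq K) => linPerp (Fintype.card Fq ^ r) (F.map (frob Fq i))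

variable {n : ℕ}

/-- `F` is a `Q`-linearized polynomial whose residue class modulo `x ^ (Q ^ n) - x` is the class of
`c_0 x + c_1 x ^ Q + ⋯ + c_{n-1} x ^ (Q ^ (n-1))` for some codeword `c`. -/
def InSkewIdeal {K : Type*} [Field K] (Q : ℕ) (C : Submodule K (Fin n → K)) (F : K[X]) : Prop :=
  IsLinearized Q F ∧ ∃ c ∈ C, ∃ P : K[X], IsLinearized Q P ∧
    F = ∑ i : Fin n, Polynomial.C (c i) * X ^ (Q ^ (i : ℕ)) + P.comp (X ^ (Q ^ n) - X)

/-- `G` and `H` are the generator and check polynomials of the linear `q ^ r`-cyclic code `C`: `G`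
is monic and of minimal degree among the nonzero `q ^ r`-linearized polynomials whose class
corresponds to a codeword, and `x ^ (q ^ (r n)) - x = G ⊗ H = H ⊗ G`. -/
structure IsSkewGenCheck [NeZero n] (r : ℕ) (C : Submodule K (Fin n → K)) (G H : K[X]) :
    Prop where
  skewCyclic : IsSkewCyclic Fq r C
  monic : G.Monic
  mem : InSkewIdeal (Fintype.card Fq ^ r) C G
  minimal : ∀ F : K[X], InSkewIdeal (Fintype.card Fq ^ r) C F → F ≠ 0 →
    G.natDegree ≤ F.natDegree
  linearized : IsLinearized (Fintype.card Fq ^ r) H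
  comp_eq : G.comp H = X ^ (Fintype.card Fq ^ (r * n)) - X
  comp_eq' : H.comp G = X ^ (Fintype.card Fq ^ (r * n)) - X

end SkewGenerators

end SkewCyclic

end

open SkewCyclic

/-! Write Q = q^r. A linear code is `q ^ r`-cyclic precisely so that the linearized polynomials
representing its words modulo x^(Q^n) - x form a left ideal: raising such a polynomial to the power
Q applies the skew shift to its word. Right division makes this ideal principal, with the generator
polynomial as generator (`IsSkewGenerator.inSkewIdeal_iff`). Hence intersections of codes correspond
to right lcms and sums to right gcds (`isRightLcm_of_iInf`, `isRightGcd_of_iSup`). Since θ_i carries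
generators to generators, this gives G^* and G^0.

Check polynomials are reached by duality. If H is the check polynomial of D, then H^⊥ generates the
dual code (`IsSkewGenCheck.linPerp_generator`). The dual of a sum is the intersection of the duals
and conversely, so the lcm (gcd) of the θ_i(H)^⊥ is B^⊥, where B is the check polynomial of C^* (of
C^0). The operation ⊤ recovers B from B^⊥ (`linTop_linPerp`), which gives H_0 and H_*.

Finally C^* and C^0 are stable under Frobenius. For such a code the skew shift and the ordinary
shift differ by a map preserving the code, and uniqueness makes the generator and check polynomials
Frobenius-invariant. On right factors with coefficients fixed by the power Q, L turns products into
compositions (`linearize_mul`), so the conventional and skew data correspond under L. -/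

namespace SkewCyclic

set_option linter.unusedSectionVars false

/-- `Q > 1` is a power of the characteristic of `K`. -/
def IsFrobeniusPower (K : Type*) [Field K] (Q : ℕ) : Prop :=
  1 < Q ∧ ∃ p k : ℕ, p.Prime ∧ CharP K p ∧ Q = p ^ k

/-! ### Arithmetic of linearized polynomials under composition -/

section LinearizedApi

variable {K : Type*} [Field K] {Q : ℕ}

theorem IsFrobeniusPower.add_pow (hQ : IsFrobeniusPower K Q) (i : ℕ) (a b : K[X]) :
    (a + b) ^ Q ^ i = a ^ Q ^ i + b ^ Q ^ i := by
  obtain ⟨-, p, k, hp, hc, rfl⟩ := hQ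
  have := Fact.mk hp
  rw [← pow_mul]
  exact add_pow_char_pow a b p _

theorem IsFrobeniusPower.add_pow_field (hQ : IsFrobeniusPower K Q) (i : ℕ) (a b : K) :
    (a + b) ^ Q ^ i = a ^ Q ^ i + b ^ Q ^ i := by
  have := hQ.add_pow i (C a) (C b)
  rw [← C_add, ← C_pow, ← C_pow, ← C_pow, ← C_add] at this
  exact C_injective this

theorem IsFrobeniusPower.pos (hQ : IsFrobeniusPower K Q) : 0 < Q := hQ.1.le

theorem IsFrobeniusPower.pow_ne_zero (hQ : IsFrobeniusPower K Q) (i : ℕ) : Q ^ i ≠ 0 :=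
  _root_.pow_ne_zero _ hQ.pos.ne'

theorem IsFrobeniusPower.pow_inj (hQ : IsFrobeniusPower K Q) {i j : ℕ} :
    Q ^ i = Q ^ j ↔ i = j :=
  (Nat.pow_right_injective hQ.1).eq_iff

theorem IsFrobeniusPower.coeff_term (hQ : IsFrobeniusPower K Q) (a : K) (i j : ℕ) :
    (C a * X ^ Q ^ i).coeff (Q ^ j) = if j = i then a else 0 := by
  simp [coeff_C_mul, coeff_X_pow, hQ.pow_inj]

theorem IsLinearized.zero : IsLinearized Q (0 : K[X]) := fun _ h => absurd (coeff_zero _) h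

theorem IsLinearized.add {F G : K[X]} (hF : IsLinearized Q F) (hG : IsLinearized Q G) :
    IsLinearized Q (F + G) := by
  intro k hk
  by_cases h : F.coeff k = 0
  · exact hG k (by simpa [h] using hk)
  · exact hF k h

theorem IsLinearized.C_mul {F : K[X]} (hF : IsLinearized Q F) (a : K) :
    IsLinearized Q (C a * F) := fun k hk =>
  hF k (right_ne_zero_of_mul (by simpa using hk))

theorem IsLinearized.neg {F : K[X]} (hF : IsLinearized Q F) : IsLinearized Q (-F) :=
  fun k hk => hF k (by simpa using hk)

theorem IsLinearized.sub {F G : K[X]} (hF : IsLinearized Q F) (hG : IsLinearized Q G) :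
    IsLinearized Q (F - G) := sub_eq_add_neg F G ▸ hF.add hG.neg

theorem isLinearized_X_pow (i : ℕ) : IsLinearized Q (X ^ Q ^ i : K[X]) := fun k hk =>
  ⟨i, by by_contra h; exact hk (by simp [coeff_X_pow, h])⟩

theorem isLinearized_X : IsLinearized Q (X : K[X]) := by
  simpa using isLinearized_X_pow (K := K) (Q := Q) 0

theorem isLinearized_term (a : K) (i : ℕ) : IsLinearized Q (C a * X ^ Q ^ i) :=
  (isLinearized_X_pow i).C_mul a

theorem IsLinearized.sum {ι : Type*} (s : Finset ι) {f : ι → K[X]}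
    (h : ∀ i ∈ s, IsLinearized Q (f i)) : IsLinearized Q (∑ i ∈ s, f i) :=
  Finset.sum_induction f (IsLinearized Q) (fun _ _ => IsLinearized.add) IsLinearized.zero h

theorem IsLinearized.induction {motive : K[X] → Prop} (zero : motive 0)
    (add : ∀ F G, IsLinearized Q F → IsLinearized Q G → motive F → motive G → motive (F + G))
    (term : ∀ a i, motive (C a * X ^ Q ^ i)) {F : K[X]} (hF : IsLinearized Q F) : motive F := by
  rw [F.as_sum_support_C_mul_X_pow]
  refine (Finset.sum_induction (fun i => C (F.coeff i) * X ^ i)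
    (fun G => IsLinearized Q G ∧ motive G)
    (fun _ _ h h' => ⟨h.1.add h'.1, add _ _ h.1 h'.1 h.2 h'.2⟩) ⟨IsLinearized.zero, zero⟩ ?_).2
  intro k hk
  obtain ⟨i, rfl⟩ := hF k (mem_support_iff.mp hk)
  exact ⟨isLinearized_term _ _, term _ _⟩

theorem IsLinearized.ext {F G : K[X]} (hF : IsLinearized Q F) (hG : IsLinearized Q G)
    (h : ∀ i, F.coeff (Q ^ i) = G.coeff (Q ^ i)) : F = G := by
  have hd := hF.sub hG
  rw [← sub_eq_zero]
  ext k
  by_contra hk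
  obtain ⟨i, rfl⟩ := hd k hk
  exact hk (by simp [h])

theorem IsLinearized.natDegree_eq {F : K[X]} (hF : IsLinearized Q F) (h0 : F ≠ 0) :
    ∃ d, F.natDegree = Q ^ d :=
  hF _ (leadingCoeff_ne_zero.mpr h0)

theorem IsLinearized.coeff_zero (hQ : IsFrobeniusPower K Q) {F : K[X]}
    (hF : IsLinearized Q F) : F.coeff 0 = 0 := by
  by_contra h
  obtain ⟨i, hi⟩ := hF 0 h
  exact hQ.pow_ne_zero i hi.symm

theorem IsLinearized.eq_zero_of_natDegree (hQ : IsFrobeniusPower K Q) {F : K[X]}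
    (hF : IsLinearized Q F) (h : F.natDegree = 0) : F = 0 := by
  rw [eq_C_of_natDegree_eq_zero h, hF.coeff_zero hQ, C_0]

theorem IsLinearized.eq_C_mul_X (hQ : IsFrobeniusPower K Q) {F : K[X]}
    (hF : IsLinearized Q F) (h : F.natDegree = 1) : F = C (F.coeff 1) * X := by
  conv_lhs => rw [eq_X_add_C_of_natDegree_le_one h.le, hF.coeff_zero hQ]
  simp

theorem IsLinearized.pow (hQ : IsFrobeniusPower K Q) {F : K[X]} (hF : IsLinearized Q F)
    (i : ℕ) : IsLinearized Q (F ^ Q ^ i) := by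
  refine hF.induction (motive := fun F => IsLinearized Q (F ^ Q ^ i)) ?_ ?_ ?_
  · rw [zero_pow (hQ.pow_ne_zero i)]; exact IsLinearized.zero
  · intro F G _ _ h h'; rw [hQ.add_pow]; exact h.add h'
  · intro a j
    rw [mul_pow, ← C_pow, ← pow_mul, ← pow_add]
    exact isLinearized_term _ _

theorem IsLinearized.coeff_pow (hQ : IsFrobeniusPower K Q) {F : K[X]} (hF : IsLinearized Q F)
    (i k : ℕ) :
    (F ^ Q ^ i).coeff (Q ^ k) = if i ≤ k then F.coeff (Q ^ (k - i)) ^ Q ^ i else 0 := by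
  refine hF.induction (motive := fun F => (F ^ Q ^ i).coeff (Q ^ k) =
    if i ≤ k then F.coeff (Q ^ (k - i)) ^ Q ^ i else 0) ?_ ?_ ?_
  · simp [zero_pow (hQ.pow_ne_zero i)]
  · intro F G _ _ h h'
    rw [hQ.add_pow, coeff_add, h, h']
    split_ifs
    · rw [coeff_add, hQ.add_pow_field]
    · simp
  · intro a j
    rw [mul_pow, ← C_pow, ← pow_mul, ← pow_add, hQ.coeff_term, hQ.coeff_term]
    by_cases h : i ≤ k
    · have : k = j + i ↔ k - i = j := by omega
      simp only [h, if_true, this, ite_pow, zero_pow (hQ.pow_ne_zero i)]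
    · have : k ≠ j + i := by omega
      simp [h, this]

theorem IsLinearized.comp (hQ : IsFrobeniusPower K Q) {F G : K[X]} (hF : IsLinearized Q F)
    (hG : IsLinearized Q G) : IsLinearized Q (F.comp G) := by
  refine hF.induction (motive := fun F => IsLinearized Q (F.comp G)) ?_ ?_ ?_
  · simpa using IsLinearized.zero
  · intro F G _ _ h h'; rw [add_comp]; exact h.add h'
  · intro a i
    simpa using (hG.pow hQ i).C_mul a

theorem IsLinearized.comp_add (hQ : IsFrobeniusPower K Q) {F : K[X]} (hF : IsLinearized Q F)
    (A B : K[X]) : F.comp (A + B) = F.comp A + F.comp B := by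
  refine hF.induction (motive := fun F => F.comp (A + B) = F.comp A + F.comp B) ?_ ?_ ?_
  · simp
  · intro F G _ _ h h'; simp only [add_comp, h, h']; ring
  · intro a i
    simp [hQ.add_pow, mul_add]

theorem IsLinearized.comp_sub (hQ : IsFrobeniusPower K Q) {F : K[X]} (hF : IsLinearized Q F)
    (A B : K[X]) : F.comp (A - B) = F.comp A - F.comp B := by
  have := hF.comp_add hQ (A - B) B
  rw [sub_add_cancel] at this
  rw [this, add_sub_cancel_right]

theorem comp_right_cancel {A B D : K[X]} (hD : D.natDegree ≠ 0) (h : A.comp D = B.comp D) :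
    A = B := by
  rw [← sub_eq_zero]
  have h0 : (A - B).comp D = 0 := by rw [sub_comp, h, sub_self]
  rcases comp_eq_zero_iff.mp h0 with h | ⟨-, h⟩
  · exact h
  · exact absurd (by rw [h, natDegree_C]) hD

theorem IsLinearized.natDegree_ne_zero (hQ : IsFrobeniusPower K Q) {F : K[X]}
    (hF : IsLinearized Q F) (h : F ≠ 0) : F.natDegree ≠ 0 :=
  fun h' => h (hF.eq_zero_of_natDegree hQ h')

/-- Right division with remainder in the ring of linearized polynomials. -/
theorem IsLinearized.exists_division (hQ : IsFrobeniusPower K Q) {D : K[X]}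
    (hD : IsLinearized Q D) (hm : D.Monic) {F : K[X]} (hF : IsLinearized Q F) :
    ∃ P R : K[X], IsLinearized Q P ∧ IsLinearized Q R ∧ F = P.comp D + R ∧
      (R = 0 ∨ R.natDegree < D.natDegree) := by
  induction hN : F.natDegree using Nat.strong_induction_on generalizing F with
  | _ N ih =>
    by_cases h0 : F = 0
    · exact ⟨0, 0, .zero, .zero, by simp [h0], Or.inl rfl⟩
    by_cases hlt : F.natDegree < D.natDegree
    · exact ⟨0, F, .zero, hF, by simp, Or.inr hlt⟩
    obtain ⟨d, hd⟩ := hF.natDegree_eq h0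
    obtain ⟨e, he⟩ := hD.natDegree_eq hm.ne_zero
    have hle : e ≤ d := by
      rw [hd, he, not_lt] at hlt
      exact (Nat.pow_le_pow_iff_right hQ.1).mp hlt
    -- D is monic of degree Q^e, so T ∘ D has the leading term of F, and subtracting it lowers the
    -- degree.
    set T : K[X] := C F.leadingCoeff * X ^ Q ^ (d - e) with hT
    have hTl : IsLinearized Q T := isLinearized_term _ _
    have hc : T.comp D = C F.leadingCoeff * D ^ Q ^ (d - e) := by simp [hT]
    have hlc : F.leadingCoeff ≠ 0 := leadingCoeff_ne_zero.mpr h0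
    have hdeg : (T.comp D).natDegree = F.natDegree := by
      rw [hc, natDegree_C_mul hlc, natDegree_pow, he, hd, ← pow_add, Nat.sub_add_cancel hle]
    have hlead : (T.comp D).leadingCoeff = F.leadingCoeff := by
      rw [hc, leadingCoeff_mul, leadingCoeff_C, (hm.pow _).leadingCoeff, mul_one]
    have hR := hF.sub (hTl.comp hQ hD)
    by_cases hz : F - T.comp D = 0
    · exact ⟨T, 0, hTl, .zero, by rw [add_zero]; exact sub_eq_zero.mp hz, Or.inl rfl⟩
    have hT0 : T.comp D ≠ 0 := by
      rw [← leadingCoeff_ne_zero, hlead]; exact hlc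
    have hlt' : (F - T.comp D).natDegree < F.natDegree :=
      natDegree_lt_natDegree hz <| degree_sub_lt_left
        (by rw [degree_eq_natDegree h0, degree_eq_natDegree hT0, hdeg]) h0 hlead.symm
    obtain ⟨P, R, hP, hR', e1, e2⟩ := ih _ (hN ▸ hlt') hR rfl
    exact ⟨P + T, R, hP.add hTl, hR', by rw [add_comp, add_right_comm, ← e1]; ring, e2⟩

theorem RightDvd.trans (hQ : IsFrobeniusPower K Q) {A B D : K[X]} (h : RightDvd Q A B)
    (h' : RightDvd Q B D) : RightDvd Q A D := by
  obtain ⟨P, hP, rfl⟩ := h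
  obtain ⟨P', hP', rfl⟩ := h'
  exact ⟨P'.comp P, hP'.comp hQ hP, (comp_assoc _ _ _).symm⟩

theorem RightDvd.add {A B D : K[X]} (h : RightDvd Q A B) (h' : RightDvd Q A D) :
    RightDvd Q A (B + D) := by
  obtain ⟨P, hP, rfl⟩ := h
  obtain ⟨P', hP', rfl⟩ := h'
  exact ⟨P + P', hP.add hP', add_comp.symm⟩

theorem rightDvd_zero {A : K[X]} : RightDvd Q A 0 := ⟨0, .zero, by simp⟩

theorem rightDvd_comp {A P : K[X]} (hP : IsLinearized Q P) : RightDvd Q A (P.comp A) :=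
  ⟨P, hP, rfl⟩

/-- Degrees multiply under composition, so the two quotients have degree 1. A linearized polynomial
of degree 1 is a scalar times x, and monicity forces the scalar to be 1. -/
theorem RightDvd.antisymm (hQ : IsFrobeniusPower K Q) {A B : K[X]} (hA : A.Monic) (hB : B.Monic)
    (hl : IsLinearized Q B) (h : RightDvd Q A B) (h' : RightDvd Q B A) : A = B := by
  obtain ⟨P, hP, hPe⟩ := h
  obtain ⟨P', hP', hPe'⟩ := h'
  have hB0 := hl.natDegree_ne_zero hQ hB.ne_zero
  have hd := congrArg natDegree hPe
  have hd' := congrArg natDegree hPe'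
  rw [natDegree_comp] at hd hd'
  have h1 : P.natDegree * P'.natDegree = 1 := by
    rw [hd', ← mul_assoc] at hd
    exact (Nat.eq_of_mul_eq_mul_right (Nat.pos_of_ne_zero hB0) (by rw [← hd, one_mul]))
  have h2 : P'.natDegree = 1 := Nat.eq_one_of_mul_eq_one_left h1
  rw [hP'.eq_C_mul_X hQ h2, mul_comp, C_comp, X_comp] at hPe'
  have hlc := congrArg leadingCoeff hPe'
  rw [leadingCoeff_mul, leadingCoeff_C, hA.leadingCoeff, hB.leadingCoeff, mul_one] at hlc
  rw [hPe', ← hlc, C_1, one_mul]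

theorem IsRightGcd.unique (hQ : IsFrobeniusPower K Q) {ι : Type*} {S : ι → K[X]} {A B : K[X]}
    (hA : IsRightGcd Q S A) (hB : IsRightGcd Q S B) : A = B :=
  RightDvd.antisymm hQ hA.monic hB.monic hB.linearized (hB.greatest _ hA.linearized hA.dvd)
    (hA.greatest _ hB.linearized hB.dvd)

theorem IsRightLcm.unique (hQ : IsFrobeniusPower K Q) {ι : Type*} {S : ι → K[X]} {A B : K[X]}
    (hA : IsRightLcm Q S A) (hB : IsRightLcm Q S B) : A = B :=
  RightDvd.antisymm hQ hA.monic hB.monic hB.linearized (hA.least _ hB.linearized hB.dvd)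
    (hB.least _ hA.linearized hA.dvd)

theorem IsRightGcd.rightGcd_eq (hQ : IsFrobeniusPower K Q) {ι : Type*} {S : ι → K[X]} {D : K[X]}
    (hD : IsRightGcd Q S D) : rightGcd Q S = D := by
  have h : ∃ D, IsRightGcd Q S D := ⟨D, hD⟩
  rw [rightGcd, dif_pos h]
  exact h.choose_spec.unique hQ hD

theorem IsRightLcm.rightLcm_eq (hQ : IsFrobeniusPower K Q) {ι : Type*} {S : ι → K[X]} {D : K[X]}
    (hD : IsRightLcm Q S D) : rightLcm Q S = D := by
  have h : ∃ D, IsRightLcm Q S D := ⟨D, hD⟩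
  rw [rightLcm, dif_pos h]
  exact h.choose_spec.unique hQ hD

theorem linDegree_eq (hQ : IsFrobeniusPower K Q) {F : K[X]} {d : ℕ} (h : F.natDegree = Q ^ d) :
    linDegree Q F = d := by
  rw [linDegree, h, Nat.log_pow hQ.1]

theorem isLinearized_linearize (f : K[X]) : IsLinearized Q (linearize Q f) :=
  IsLinearized.sum _ fun _ _ => isLinearized_term _ _

theorem coeff_linearize (hQ : IsFrobeniusPower K Q) (f : K[X]) (i : ℕ) :
    (linearize Q f).coeff (Q ^ i) = f.coeff i := by
  rw [linearize, sum_def, finsetSum_coeff]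
  simp only [hQ.coeff_term]
  simp +contextual [eq_comm]

theorem linearize_injective (hQ : IsFrobeniusPower K Q) :
    Function.Injective (linearize Q : K[X] → K[X]) := fun f g h =>
  Polynomial.ext fun i => by rw [← coeff_linearize hQ, h, coeff_linearize hQ]

theorem IsLinearized.exists_linearize (hQ : IsFrobeniusPower K Q) {F : K[X]}
    (hF : IsLinearized Q F) : ∃ f, F = linearize Q f := by
  refine hF.induction (motive := fun F => ∃ f, F = linearize Q f) ⟨0, by simp [linearize]⟩ ?_ ?_
  · rintro _ _ - - ⟨f, rfl⟩ ⟨g, rfl⟩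
    refine ⟨f + g, IsLinearized.ext (.add (isLinearized_linearize f) (isLinearized_linearize g))
      (isLinearized_linearize _) fun i => ?_⟩
    simp [coeff_linearize hQ]
  · exact fun a i => ⟨monomial i a, by simp [linearize]⟩

theorem natDegree_linearize (hQ : IsFrobeniusPower K Q) {f : K[X]} (hf : f ≠ 0) :
    (linearize Q f).natDegree = Q ^ f.natDegree := by
  refine natDegree_eq_of_le_of_coeff_ne_zero ?_ ?_
  · refine natDegree_le_iff_coeff_eq_zero.mpr fun k hk => ?_
    by_contra h
    obtain ⟨i, rfl⟩ := isLinearized_linearize f k h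
    rw [coeff_linearize hQ] at h
    exact absurd (Nat.pow_le_pow_right hQ.pos (le_natDegree_of_ne_zero h)) (not_le.mpr hk)
  · rw [coeff_linearize hQ]
    exact leadingCoeff_ne_zero.mpr hf

theorem monic_linearize (hQ : IsFrobeniusPower K Q) {f : K[X]} :
    (linearize Q f).Monic ↔ f.Monic := by
  by_cases hf : f = 0
  · simp [hf, linearize]
  · rw [Monic, leadingCoeff, natDegree_linearize hQ hf, coeff_linearize hQ]
    rfl

/-- Composing x^(Q^i) with L(h) raises the coefficients of h to the power Q^i; this twist is the
only obstruction to multiplicativity, and `hh` removes it. -/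
theorem linearize_mul (hQ : IsFrobeniusPower K Q) (f : K[X]) {h : K[X]}
    (hh : ∀ i, h.coeff i ^ Q = h.coeff i) :
    linearize Q (f * h) = (linearize Q f).comp (linearize Q h) := by
  have hpow : ∀ i j, h.coeff j ^ Q ^ i = h.coeff j := by
    intro i j
    induction i with
    | zero => simp
    | succ i ih => rw [pow_succ, pow_mul, ih, hh]
  induction f using Polynomial.induction_on' with
  | add f g hf hg =>
    have hadd : ∀ a b : K[X], linearize Q (a + b) = linearize Q a + linearize Q b := fun a b =>
      (isLinearized_linearize _).ext ((isLinearized_linearize _).add (isLinearized_linearize _))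
        fun i => by simp [coeff_linearize hQ]
    rw [add_mul, hadd, hadd, add_comp, hf, hg]
  | monomial i a =>
    have hm : linearize Q (monomial i a) = C a * X ^ Q ^ i := by simp [linearize]
    refine (isLinearized_linearize _).ext
      ((isLinearized_linearize _).comp hQ (isLinearized_linearize _)) fun k => ?_
    rw [hm, mul_comp, C_comp, X_pow_comp, coeff_C_mul,
      (isLinearized_linearize h).coeff_pow hQ, coeff_linearize hQ, ← C_mul_X_pow_eq_monomial,
      mul_assoc, coeff_C_mul, coeff_X_pow_mul', coeff_linearize hQ, hpow]

end LinearizedApi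

/-! ### Codewords as residues modulo x^(Q^n) - x -/

section Ideal

variable {K : Type*} [Field K] {Q n : ℕ}

theorem isLinearized_modulus : IsLinearized Q (X ^ Q ^ n - X : K[X]) :=
  (isLinearized_X_pow n).sub isLinearized_X

theorem IsFrobeniusPower.one_lt_pow (hQ : IsFrobeniusPower K Q) (hn : n ≠ 0) : 1 < Q ^ n :=
  Nat.one_lt_pow hn hQ.1

theorem natDegree_modulus (hQ : IsFrobeniusPower K Q) (hn : n ≠ 0) :
    (X ^ Q ^ n - X : K[X]).natDegree = Q ^ n := by
  have := hQ.one_lt_pow hn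
  rw [natDegree_sub_eq_left_of_natDegree_lt] <;> simp [this]

theorem monic_modulus (hQ : IsFrobeniusPower K Q) (hn : n ≠ 0) :
    (X ^ Q ^ n - X : K[X]).Monic := by
  have := hQ.one_lt_pow hn
  exact monic_X_pow_sub (by rw [degree_X]; exact_mod_cast this)

theorem coeff_modulus (hQ : IsFrobeniusPower K Q) (i : ℕ) :
    (X ^ Q ^ n - X : K[X]).coeff (Q ^ i) = (if i = n then 1 else 0) - if i = 0 then 1 else 0 := by
  have h : (1 = Q ^ i) ↔ i = 0 := by
    rw [← pow_zero Q, hQ.pow_inj, eq_comm]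
  rw [coeff_sub, coeff_X_pow, coeff_X]
  simp [hQ.pow_inj, h]

/-- The linearized polynomial `c_0 x + c_1 x ^ Q + ⋯ + c_{n-1} x ^ (Q ^ (n-1))`. -/
noncomputable def vecPoly (Q : ℕ) (c : Fin n → K) : K[X] :=
  ∑ i : Fin n, C (c i) * X ^ Q ^ (i : ℕ)

theorem isLinearized_vecPoly (c : Fin n → K) : IsLinearized Q (vecPoly Q c) :=
  IsLinearized.sum _ fun _ _ => isLinearized_term _ _

theorem coeff_vecPoly (hQ : IsFrobeniusPower K Q) (c : Fin n → K) (k : ℕ) :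
    (vecPoly Q c).coeff (Q ^ k) = if h : k < n then c ⟨k, h⟩ else 0 := by
  rw [vecPoly, finsetSum_coeff]
  simp only [hQ.coeff_term]
  split_ifs with h
  · rw [Finset.sum_eq_single ⟨k, h⟩]
    · simp
    · intro b _ hb
      rw [if_neg]
      rintro rfl
      exact hb rfl
    · simp
  · refine Finset.sum_eq_zero fun i _ => if_neg ?_
    rintro rfl
    exact h i.2

theorem coeff_vecPoly_fin (hQ : IsFrobeniusPower K Q) (c : Fin n → K) (i : Fin n) :
    (vecPoly Q c).coeff (Q ^ (i : ℕ)) = c i := by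
  rw [coeff_vecPoly hQ, dif_pos i.2]

theorem vecPoly_injective (hQ : IsFrobeniusPower K Q) :
    Function.Injective (vecPoly Q : (Fin n → K) → K[X]) := fun c c' h =>
  funext fun i => by rw [← coeff_vecPoly_fin hQ c, h, coeff_vecPoly_fin hQ]

theorem vecPoly_add (c c' : Fin n → K) : vecPoly Q (c + c') = vecPoly Q c + vecPoly Q c' := by
  simp [vecPoly, add_mul, Finset.sum_add_distrib]

theorem vecPoly_smul (a : K) (c : Fin n → K) : vecPoly Q (a • c) = C a * vecPoly Q c := by
  simp [vecPoly, Finset.mul_sum, mul_assoc]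

theorem vecPoly_zero : vecPoly Q (0 : Fin n → K) = 0 := by
  simp [vecPoly]

theorem natDegree_vecPoly_lt (hQ : IsFrobeniusPower K Q) (hn : n ≠ 0) (c : Fin n → K) :
    (vecPoly Q c).natDegree < Q ^ n := by
  by_cases h0 : vecPoly Q c = 0
  · rw [h0, natDegree_zero]
    exact zero_lt_one.trans (hQ.one_lt_pow hn)
  obtain ⟨d, hd⟩ := (isLinearized_vecPoly c).natDegree_eq h0
  have h1 := leadingCoeff_ne_zero.mpr h0
  rw [leadingCoeff, hd, coeff_vecPoly hQ] at h1
  rw [hd]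
  refine Nat.pow_lt_pow_right hQ.1 ?_
  by_contra h
  exact h1 (dif_neg h)

theorem exists_vecPoly (hQ : IsFrobeniusPower K Q) {F : K[X]} (hF : IsLinearized Q F)
    (h : F.natDegree < Q ^ n) : F = vecPoly Q fun i : Fin n => F.coeff (Q ^ (i : ℕ)) := by
  refine hF.ext (isLinearized_vecPoly _) fun k => ?_
  rw [coeff_vecPoly hQ]
  split_ifs with hk
  · rfl
  · exact coeff_eq_zero_of_natDegree_lt
      (h.trans_le (Nat.pow_le_pow_right hQ.pos (not_lt.mp hk)))

theorem inSkewIdeal_iff {D : Submodule K (Fin n → K)} {F : K[X]} :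
    InSkewIdeal Q D F ↔ IsLinearized Q F ∧ ∃ c ∈ D, ∃ P : K[X], IsLinearized Q P ∧
      F = vecPoly Q c + P.comp (X ^ Q ^ n - X) := Iff.rfl

theorem inSkewIdeal_vecPoly {D : Submodule K (Fin n → K)} {c : Fin n → K} (hc : c ∈ D) :
    InSkewIdeal Q D (vecPoly Q c) :=
  ⟨isLinearized_vecPoly c, c, hc, 0, .zero, by simp [vecPoly]⟩

theorem inSkewIdeal_modulus (D : Submodule K (Fin n → K)) :
    InSkewIdeal Q D (X ^ Q ^ n - X) :=
  ⟨isLinearized_modulus, 0, D.zero_mem, X, isLinearized_X, by simp⟩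

/-- Representations modulo `x ^ (Q ^ n) - x` are unique. -/
theorem vecPoly_add_comp_inj (hQ : IsFrobeniusPower K Q) (hn : n ≠ 0) {c c' : Fin n → K}
    {P P' : K[X]} (hP : IsLinearized Q P) (hP' : IsLinearized Q P')
    (h : vecPoly Q c + P.comp (X ^ Q ^ n - X) = vecPoly Q c' + P'.comp (X ^ Q ^ n - X)) :
    c = c' ∧ P = P' := by
  have hPP : P = P' := by
    by_contra hne
    have h1 : (P - P').comp (X ^ Q ^ n - X) = vecPoly Q (c' + (-1 : K) • c) := by
      rw [vecPoly_add, vecPoly_smul, sub_comp, C_neg, C_1]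
      linear_combination h
    have h2 := natDegree_vecPoly_lt hQ hn (c' + (-1 : K) • c)
    rw [← h1, natDegree_comp, natDegree_modulus hQ hn] at h2
    have h3 := (hP.sub hP').natDegree_ne_zero hQ (sub_ne_zero.mpr hne)
    exact absurd h2 (not_lt.mpr (Nat.le_mul_of_pos_left _ (Nat.pos_of_ne_zero h3)))
  subst hPP
  exact ⟨vecPoly_injective hQ (add_right_cancel h), rfl⟩

theorem InSkewIdeal.exists_of_natDegree_lt (hQ : IsFrobeniusPower K Q) (hn : n ≠ 0)
    {D : Submodule K (Fin n → K)} {F : K[X]} (hF : InSkewIdeal Q D F)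
    (h : F.natDegree < Q ^ n) : ∃ c ∈ D, F = vecPoly Q c := by
  obtain ⟨hl, c, hc, P, hP, he⟩ := hF
  refine ⟨c, hc, ?_⟩
  change F = vecPoly Q c + _ at he
  have h1 := exists_vecPoly hQ hl h
  have h2 := vecPoly_add_comp_inj hQ hn hP IsLinearized.zero
    (c := c) (c' := fun i : Fin n => F.coeff (Q ^ (i : ℕ))) (by rw [← he, ← h1]; simp)
  rw [h2.1, ← h1]

theorem InSkewIdeal.add {D : Submodule K (Fin n → K)} {F G : K[X]} (hF : InSkewIdeal Q D F)
    (hG : InSkewIdeal Q D G) : InSkewIdeal Q D (F + G) := by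
  rw [inSkewIdeal_iff] at *
  obtain ⟨hl, c, hc, P, hP, rfl⟩ := hF
  obtain ⟨hl', c', hc', P', hP', rfl⟩ := hG
  exact ⟨hl.add hl', c + c', D.add_mem hc hc', P + P', hP.add hP', by
    rw [vecPoly_add, add_comp]; ring⟩

theorem InSkewIdeal.C_mul {D : Submodule K (Fin n → K)} {F : K[X]} (hF : InSkewIdeal Q D F)
    (a : K) : InSkewIdeal Q D (C a * F) := by
  rw [inSkewIdeal_iff] at *
  obtain ⟨hl, c, hc, P, hP, rfl⟩ := hF
  exact ⟨hl.C_mul a, a • c, D.smul_mem a hc, C a * P, hP.C_mul a, by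
    rw [vecPoly_smul, mul_comp, C_comp]; ring⟩

theorem InSkewIdeal.sub {D : Submodule K (Fin n → K)} {F G : K[X]} (hF : InSkewIdeal Q D F)
    (hG : InSkewIdeal Q D G) : InSkewIdeal Q D (F - G) := by
  have := hF.add (hG.C_mul (-1))
  rwa [C_neg, C_1, neg_one_mul, ← sub_eq_add_neg] at this

theorem InSkewIdeal.mono {D D' : Submodule K (Fin n → K)} (h : D ≤ D') {F : K[X]}
    (hF : InSkewIdeal Q D F) : InSkewIdeal Q D' F := by
  obtain ⟨hl, c, hc, P⟩ := hF
  exact ⟨hl, c, h hc, P⟩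

/-- The codeword representing F is unique, so the one found for a single index lies in every code of
the family. -/
theorem inSkewIdeal_iInf (hQ : IsFrobeniusPower K Q) (hn : n ≠ 0) {ι : Type*} [Nonempty ι]
    {D : ι → Submodule K (Fin n → K)} {F : K[X]} :
    InSkewIdeal Q (⨅ i, D i) F ↔ ∀ i, InSkewIdeal Q (D i) F := by
  refine ⟨fun h i => h.mono (iInf_le D i), fun h => ?_⟩
  inhabit ι
  obtain ⟨hl, c, hc, P, hP, he⟩ := inSkewIdeal_iff.mp (h default)
  refine inSkewIdeal_iff.mpr ⟨hl, c, (Submodule.mem_iInf D).mpr fun i => ?_, P, hP, he⟩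
  obtain ⟨-, c', hc', P', hP', he'⟩ := inSkewIdeal_iff.mp (h i)
  rwa [(vecPoly_add_comp_inj hQ hn hP hP' (he.symm.trans he')).1]

end Ideal

/-! ### Frobenius action and skew shift on words -/

section Generators

variable (Fq : Type*) {K : Type*} [Field Fq] [Fintype Fq] [Field K] [Finite K] [Algebra Fq K]
  {n : ℕ}

theorem isFrobeniusPower_card_pow {r : ℕ} (hr : 0 < r) :
    IsFrobeniusPower K (Fintype.card Fq ^ r) := by
  refine ⟨Nat.one_lt_pow hr.ne' Fintype.one_lt_card, ?_⟩
  obtain ⟨p, hp⟩ := CharP.exists Fq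
  obtain ⟨k, hprime, hk⟩ := FiniteField.card Fq p
  exact ⟨p, k * r, hprime, charP_of_injective_algebraMap (algebraMap Fq K).injective p, by
    rw [hk, pow_mul]⟩

theorem pow_card_pow_of_dvd {s : ℕ} (h : Module.finrank Fq K ∣ s) (a : K) :
    a ^ Fintype.card Fq ^ s = a := by
  have := Fintype.ofFinite K
  have hm : a ^ Fintype.card Fq ^ Module.finrank Fq K = a := by
    rw [← Module.card_eq_pow_finrank, FiniteField.pow_card]
  obtain ⟨t, rfl⟩ := h
  induction t with
  | zero => simp
  | succ t ih => rw [mul_add, mul_one, pow_add, pow_mul, ih, hm]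

theorem frobVec_frobVec (s t : ℕ) (c : Fin n → K) :
    frobVec Fq s (frobVec Fq t c) = frobVec Fq (t + s) c :=
  funext fun i => by simp only [frobVec, ← pow_mul, ← pow_add]

theorem frobVec_of_dvd {s : ℕ} (h : Module.finrank Fq K ∣ s) (c : Fin n → K) :
    frobVec Fq s c = c := funext fun i => pow_card_pow_of_dvd Fq h (c i)

theorem frobVec_add (s : ℕ) (a b : Fin n → K) :
    frobVec Fq s (a + b) = frobVec Fq s a + frobVec Fq s b :=
  funext fun i => map_add (frob Fq s) (a i) (b i)

theorem frobVec_injective (s : ℕ) :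
    Function.Injective (frobVec Fq s : (Fin n → K) → Fin n → K) := fun _ _ h =>
  funext fun i => (frob Fq s).injective (congrFun h i)

theorem shift_frobVec [NeZero n] (s : ℕ) (c : Fin n → K) :
    shift (frobVec Fq s c) = frobVec Fq s (shift c) := rfl

theorem mem_frobCode {s : ℕ} {D : Submodule K (Fin n → K)} {c : Fin n → K} :
    c ∈ frobCode Fq s D ↔ ∃ b ∈ D, frobVec Fq s b = c := Iff.rfl

theorem frobVec_mem_frobCode {s : ℕ} {D : Submodule K (Fin n → K)} {c : Fin n → K} (h : c ∈ D) :
    frobVec Fq s c ∈ frobCode Fq s D := ⟨c, h, rfl⟩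

theorem frobCode_frobCode (s t : ℕ) (D : Submodule K (Fin n → K)) :
    frobCode Fq s (frobCode Fq t D) = frobCode Fq (t + s) D := by
  ext c
  simp only [mem_frobCode]
  constructor
  · rintro ⟨_, ⟨b, hb, rfl⟩, rfl⟩
    exact ⟨b, hb, (frobVec_frobVec Fq s t b).symm⟩
  · rintro ⟨b, hb, rfl⟩
    exact ⟨_, ⟨b, hb, rfl⟩, frobVec_frobVec Fq s t b⟩

theorem frobCode_of_dvd {s : ℕ} (h : Module.finrank Fq K ∣ s) (D : Submodule K (Fin n → K)) :
    frobCode Fq s D = D := by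
  ext c
  simp [mem_frobCode, frobVec_of_dvd Fq h]

theorem IsSkewCyclic.frobCode [NeZero n] {r : ℕ} {D : Submodule K (Fin n → K)}
    (h : IsSkewCyclic Fq r D) (s : ℕ) : IsSkewCyclic Fq r (frobCode Fq s D) := by
  rintro _ ⟨c, hc, rfl⟩
  refine ⟨_, h c hc, ?_⟩
  rw [shift_frobVec, frobVec_frobVec, frobVec_frobVec, add_comm]

theorem IsSkewCyclic.iInf [NeZero n] {r : ℕ} {ι : Type*} {D : ι → Submodule K (Fin n → K)}
    (h : ∀ i, IsSkewCyclic Fq r (D i)) : IsSkewCyclic Fq r (⨅ i, D i) := fun c hc => by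
  rw [Submodule.mem_iInf] at *
  exact fun i => h i c (hc i)

theorem IsSkewCyclic.iSup [NeZero n] {r : ℕ} {ι : Type*} {D : ι → Submodule K (Fin n → K)}
    (h : ∀ i, IsSkewCyclic Fq r (D i)) : IsSkewCyclic Fq r (⨆ i, D i) := fun c hc => by
  refine Submodule.iSup_induction D (motive := fun c => frobVec Fq r (shift c) ∈ ⨆ i, D i) hc
    (fun i x hx => Submodule.mem_iSup_of_mem i (h i x hx)) ?_ ?_
  · convert Submodule.zero_mem _
    exact funext fun i => map_zero (frob Fq r : K →+* K)
  · intro x y hx hy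
    convert Submodule.add_mem _ hx hy
    exact frobVec_add Fq r _ _

theorem fin_zero_sub_one [NeZero n] (h : 0 < n) :
    (⟨0, h⟩ : Fin n) - 1 = ⟨n - 1, Nat.sub_lt h one_pos⟩ := by
  ext
  rw [Fin.val_sub, Fin.val_one']
  rcases Nat.lt_or_ge 1 n with h1 | h1
  · simp [Nat.mod_eq_of_lt h1]
  · obtain rfl : n = 1 := by omega
    simp

theorem fin_pos_sub_one [NeZero n] {k : ℕ} (hk : 0 < k) (h : k < n) :
    (⟨k, h⟩ : Fin n) - 1 = ⟨k - 1, (Nat.sub_le k 1).trans_lt h⟩ := by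
  ext
  rw [Fin.val_sub, Fin.val_one', Nat.mod_eq_of_lt (show 1 < n by omega)]
  simp only
  rw [show n - 1 + k = k - 1 + n by omega, Nat.add_mod_right, Nat.mod_eq_of_lt (by omega)]

/-- The reason for the definition of skew cyclicity: the power Q twists each coefficient and moves
it up one place. The last coefficient overflows to x^(Q^n), and a multiple of the modulus, with that
coefficient as scalar, wraps it round to x. -/
theorem vecPoly_pow [NeZero n] {r : ℕ} (hr : 0 < r) (c : Fin n → K) :
    ∃ a : K, vecPoly (Fintype.card Fq ^ r) c ^ (Fintype.card Fq ^ r) =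
      vecPoly (Fintype.card Fq ^ r) (frobVec Fq r (shift c)) +
        (C a * X).comp (X ^ (Fintype.card Fq ^ r) ^ n - X) := by
  have hQ := isFrobeniusPower_card_pow Fq (K := K) hr
  have hn : 0 < n := Nat.pos_of_ne_zero (NeZero.ne n)
  refine ⟨c ⟨n - 1, Nat.sub_lt hn one_pos⟩ ^ Fintype.card Fq ^ r, ?_⟩
  have hl := (isLinearized_vecPoly (Q := Fintype.card Fq ^ r) c).pow hQ 1
  have hc := fun k => (isLinearized_vecPoly (Q := Fintype.card Fq ^ r) c).coeff_pow hQ 1 k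
  rw [pow_one] at hl hc
  rw [mul_comp, C_comp, X_comp]
  refine hl.ext ((isLinearized_vecPoly _).add (isLinearized_modulus.C_mul _)) fun k => ?_
  rw [hc, coeff_add, coeff_C_mul, coeff_modulus hQ, coeff_vecPoly hQ, coeff_vecPoly hQ]
  rcases Nat.eq_zero_or_pos k with rfl | hk
  · simp [hn, hn.ne, frobVec, shift, -Fin.mk_zero', fin_zero_sub_one]
  · have h1 : 1 ≤ k := hk
    rcases lt_trichotomy k n with h | rfl | h
    · simp [h1, h, h.ne, hk.ne', frobVec, shift, fin_pos_sub_one hk h, (show k - 1 < n by omega)]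
    · simp [hn, h1, hk.ne']
    · simp [hk.ne', h.ne', h.not_gt, (show ¬ k - 1 < n by omega),
        zero_pow (pow_ne_zero r (Fintype.card_ne_zero (α := Fq)))]

end Generators

/-! ### Generator and check polynomials of a skew cyclic code -/

section Existence

variable (Fq : Type*) {K : Type*} [Field Fq] [Fintype Fq] [Field K] [Finite K] [Algebra Fq K]
  {n : ℕ} [NeZero n] {r : ℕ}

local notation "Q" => Fintype.card Fq ^ r

variable {Fq}

/-- Composition on the left is built from sums, scalars and powers Q; only the last needs skew
cyclicity, through `vecPoly_pow`. -/
theorem InSkewIdeal.comp (hr : 0 < r) {D : Submodule K (Fin n → K)} (hD : IsSkewCyclic Fq r D)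
    {F P : K[X]} (hF : InSkewIdeal Q D F) (hP : IsLinearized Q P) :
    InSkewIdeal Q D (P.comp F) := by
  have hQ := isFrobeniusPower_card_pow Fq (K := K) hr
  have hpow1 : ∀ F : K[X], InSkewIdeal Q D F → InSkewIdeal Q D (F ^ Q) := by
    intro F hF
    obtain ⟨hl, c, hc, P, hP, he⟩ := inSkewIdeal_iff.mp hF
    have hlQ := hl.pow hQ 1
    have hPQ := hP.pow hQ 1
    have hadd := hQ.add_pow 1 (vecPoly Q c) (P.comp (X ^ Q ^ n - X))
    rw [pow_one] at hlQ hPQ hadd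
    obtain ⟨a, ha⟩ := vecPoly_pow Fq hr c
    refine inSkewIdeal_iff.mpr ⟨hlQ, _, hD c hc, C a * X + P ^ Q,
      (isLinearized_X.C_mul a).add hPQ, ?_⟩
    rw [he, hadd, ha, add_comp (p := C a * X), pow_comp]
    ring
  have hpow : ∀ i : ℕ, InSkewIdeal Q D (F ^ Q ^ i) := by
    intro i
    induction i with
    | zero => simpa using hF
    | succ i ih =>
      rw [pow_succ, pow_mul]
      exact hpow1 _ ih
  refine hP.induction (motive := fun P => InSkewIdeal Q D (P.comp F)) ?_ ?_ ?_
  · simpa using hF.C_mul 0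
  · intro A B _ _ h h'; rw [add_comp]; exact h.add h'
  · intro a i
    rw [mul_comp, C_comp, X_pow_comp]
    exact (hpow i).C_mul a

/-- The modulus `x ^ (Q ^ n) - x` commutes with all linearized polynomials. -/
theorem comp_modulus_comm (hr : 0 < r) (hdvd : Module.finrank Fq K ∣ r * n) {F : K[X]}
    (hF : IsLinearized Q F) :
    F.comp (X ^ Q ^ n - X) = (X ^ Q ^ n - X : K[X]).comp F := by
  have hQ := isFrobeniusPower_card_pow Fq (K := K) hr
  rw [hF.comp_sub hQ, comp_X, sub_comp, X_pow_comp, X_comp]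
  congr 1
  refine hF.induction (motive := fun F => F.comp (X ^ Q ^ n) = F ^ Q ^ n) ?_ ?_ ?_
  · simp [zero_pow (hQ.pow_ne_zero n)]
  · intro A B _ _ h h'; rw [add_comp, h, h', hQ.add_pow]
  · intro a i
    -- Scalars commute with x^(Q^n) because m divides rn, so that a^(Q^n) = a on K.
    rw [mul_comp, C_comp, X_pow_comp, mul_pow, ← C_pow, ← pow_mul (Fintype.card Fq),
      pow_card_pow_of_dvd Fq hdvd, pow_right_comm]

/-- `G` is a monic element of minimal degree in the left ideal of `D`. -/
structure IsSkewGenerator (r : ℕ) (Fq : Type*) {K : Type*} [Fintype Fq] [Field K]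
    {n : ℕ} (D : Submodule K (Fin n → K)) (G : K[X]) : Prop where
  monic : G.Monic
  mem : InSkewIdeal (Fintype.card Fq ^ r) D G
  minimal : ∀ F : K[X], InSkewIdeal (Fintype.card Fq ^ r) D F → F ≠ 0 →
    G.natDegree ≤ F.natDegree

theorem IsSkewGenCheck.generator {D : Submodule K (Fin n → K)} {G H : K[X]}
    (h : IsSkewGenCheck Fq r D G H) : IsSkewGenerator r Fq D G := ⟨h.monic, h.mem, h.minimal⟩

theorem IsSkewGenerator.unique {D : Submodule K (Fin n → K)} {G G' : K[X]}
    (h : IsSkewGenerator r Fq D G) (h' : IsSkewGenerator r Fq D G') : G = G' := by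
  by_contra hne
  have hd : G.natDegree = G'.natDegree :=
    le_antisymm (h.minimal _ h'.mem h'.monic.ne_zero) (h'.minimal _ h.mem h.monic.ne_zero)
  have hsub := sub_ne_zero.mpr hne
  refine absurd (h.minimal _ (h.mem.sub h'.mem) hsub) (not_le.mpr ?_)
  refine natDegree_lt_natDegree hsub (degree_sub_lt_left ?_ h.monic.ne_zero ?_)
  · rw [degree_eq_natDegree h.monic.ne_zero, degree_eq_natDegree h'.monic.ne_zero, hd]
  · rw [h.monic.leadingCoeff, h'.monic.leadingCoeff]

theorem exists_isSkewGenerator (hr : 0 < r) (D : Submodule K (Fin n → K)) :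
    ∃ G, IsSkewGenerator r Fq D G := by
  have hQ := isFrobeniusPower_card_pow Fq (K := K) hr
  obtain ⟨F, ⟨hF, hF0⟩, hmin⟩ := exists_minimalFor_of_wellFoundedLT
    (fun F : K[X] => InSkewIdeal Q D F ∧ F ≠ 0) natDegree
    ⟨_, inSkewIdeal_modulus D, (monic_modulus hQ (NeZero.ne n)).ne_zero⟩
  have hlc := inv_ne_zero (leadingCoeff_ne_zero.mpr hF0)
  refine ⟨C F.leadingCoeff⁻¹ * F, ?_, hF.C_mul _, fun A hA hA0 => ?_⟩
  · rw [mul_comm]; exact monic_mul_leadingCoeff_inv hF0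
  · rw [natDegree_C_mul hlc]
    by_contra h
    exact h (hmin ⟨hA, hA0⟩ (not_le.mp h).le)

/-- The remainder of F on right division by G stays in the left ideal and has smaller degree than G,
so minimality kills it. -/
theorem IsSkewGenerator.inSkewIdeal_iff (hr : 0 < r) {D : Submodule K (Fin n → K)}
    (hD : IsSkewCyclic Fq r D) {G : K[X]} (h : IsSkewGenerator r Fq D G) {F : K[X]}
    (hF : IsLinearized Q F) : InSkewIdeal Q D F ↔ RightDvd Q G F := by
  have hQ := isFrobeniusPower_card_pow Fq (K := K) hr
  constructor
  · intro hI
    obtain ⟨P, R, hP, -, he, hR⟩ := h.mem.1.exists_division hQ h.monic hF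
    have hRI : InSkewIdeal Q D R := by
      rw [show R = F - P.comp G by rw [he]; ring]
      exact hI.sub (h.mem.comp hr hD hP)
    rcases hR with rfl | hR
    · exact ⟨P, hP, by rw [he, add_zero]⟩
    · by_cases hR0 : R = 0
      · exact ⟨P, hP, by rw [he, hR0, add_zero]⟩
      · exact absurd (h.minimal R hRI hR0) (not_le.mpr hR)
  · rintro ⟨P, hP, rfl⟩
    exact h.mem.comp hr hD hP

/-- The modulus represents the zero word, so it equals H ∘ G for some H. As it commutes with G,
cancelling G on the right of G ∘ H ∘ G gives G ∘ H as well. -/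
theorem IsSkewGenerator.exists_isSkewGenCheck (hr : 0 < r)
    (hdvd : Module.finrank Fq K ∣ r * n) {D : Submodule K (Fin n → K)}
    (hD : IsSkewCyclic Fq r D) {G : K[X]} (h : IsSkewGenerator r Fq D G) :
    ∃ H, IsSkewGenCheck Fq r D G H := by
  have hQ := isFrobeniusPower_card_pow Fq (K := K) hr
  obtain ⟨H, hH, he⟩ :=
    (h.inSkewIdeal_iff hr hD isLinearized_modulus).mp (inSkewIdeal_modulus D)
  refine ⟨H, hD, h.monic, h.mem, h.minimal, hH, ?_, by rw [pow_mul, he]⟩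
  rw [pow_mul]
  refine comp_right_cancel (h.mem.1.natDegree_ne_zero hQ h.monic.ne_zero) ?_
  rw [comp_assoc, ← he, comp_modulus_comm hr hdvd h.mem.1]

theorem IsSkewGenCheck.unique (hr : 0 < r) {D : Submodule K (Fin n → K)} {G H G' H' : K[X]}
    (h : IsSkewGenCheck Fq r D G H) (h' : IsSkewGenCheck Fq r D G' H') : G = G' ∧ H = H' := by
  have hQ := isFrobeniusPower_card_pow Fq (K := K) hr
  obtain rfl := h.generator.unique h'.generator
  exact ⟨rfl, comp_right_cancel (h.mem.1.natDegree_ne_zero hQ h.monic.ne_zero)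
    (h.comp_eq'.trans h'.comp_eq'.symm)⟩

theorem exists_isSkewGenCheck (hr : 0 < r) (hdvd : Module.finrank Fq K ∣ r * n)
    {D : Submodule K (Fin n → K)} (hD : IsSkewCyclic Fq r D) :
    ∃ G H, IsSkewGenCheck Fq r D G H := by
  obtain ⟨G, hG⟩ := exists_isSkewGenerator (Fq := Fq) hr D
  exact ⟨G, hG.exists_isSkewGenCheck hr hdvd hD⟩

theorem IsSkewGenCheck.comp_eq_pow {D : Submodule K (Fin n → K)} {G H : K[X]}
    (h : IsSkewGenCheck Fq r D G H) : G.comp H = X ^ Q ^ n - X := by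
  rw [h.comp_eq, pow_mul]

theorem IsSkewGenCheck.comp_eq_pow' {D : Submodule K (Fin n → K)} {G H : K[X]}
    (h : IsSkewGenCheck Fq r D G H) : H.comp G = X ^ Q ^ n - X := by
  rw [h.comp_eq', pow_mul]

/-! ### Intersections and sums of codes as lcms and gcds -/

section Family

variable {ι : Type*} [Nonempty ι] {D : ι → Submodule K (Fin n → K)} {S : ι → K[X]} {A : K[X]}

theorem isRightLcm_of_iInf (hr : 0 < r) (hD : ∀ i, IsSkewCyclic Fq r (D i))
    (hS : ∀ i, IsSkewGenerator r Fq (D i) (S i)) (hA : IsSkewGenerator r Fq (⨅ i, D i) A) :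
    IsRightLcm Q S A := by
  have hQ := isFrobeniusPower_card_pow Fq (K := K) hr
  refine ⟨hA.mem.1, hA.monic, fun i => ?_, fun E hE h => ?_⟩
  · exact ((hS i).inSkewIdeal_iff hr (hD i) hA.mem.1).mp (hA.mem.mono (iInf_le D i))
  · refine (hA.inSkewIdeal_iff hr (IsSkewCyclic.iInf Fq hD) hE).mp ?_
    exact (inSkewIdeal_iInf hQ (NeZero.ne n)).mpr
      fun i => ((hS i).inSkewIdeal_iff hr (hD i) hE).mpr (h i)

theorem isRightGcd_of_iSup (hr : 0 < r) (hD : ∀ i, IsSkewCyclic Fq r (D i))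
    (hS : ∀ i, IsSkewGenerator r Fq (D i) (S i)) (hA : IsSkewGenerator r Fq (⨆ i, D i) A) :
    IsRightGcd Q S A := by
  have hQ := isFrobeniusPower_card_pow Fq (K := K) hr
  have hsup := IsSkewCyclic.iSup Fq hD
  refine ⟨hA.mem.1, hA.monic, fun i => ?_, fun E hE h => ?_⟩
  · exact (hA.inSkewIdeal_iff hr hsup (hS i).mem.1).mp ((hS i).mem.mono (le_iSup D i))
  · obtain ⟨-, c, hc, P, hP, rfl⟩ := SkewCyclic.inSkewIdeal_iff.mp hA.mem
    refine RightDvd.add ?_ ?_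
    -- A word of the sum is a sum of words of the D i, each a right multiple of S i and hence of E.
    · refine Submodule.iSup_induction D (motive := fun c => RightDvd Q E (vecPoly Q c)) hc ?_ ?_ ?_
      · intro i x hx
        exact (h i).trans hQ (((hS i).inSkewIdeal_iff hr (hD i) (isLinearized_vecPoly x)).mp
          (inSkewIdeal_vecPoly hx))
      · rw [vecPoly_zero]; exact rightDvd_zero
      · intro x y hx hy
        rw [vecPoly_add]; exact hx.add hy
    -- The modulus lies in every ideal, so any single index shows that E divides it.
    · inhabit ι
      refine ((h default).trans hQ (((hS default).inSkewIdeal_iff hr (hD default)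
        isLinearized_modulus).mp (inSkewIdeal_modulus _))).trans hQ (rightDvd_comp hP)

end Family

/-! ### Frobenius images of generator and check polynomials -/

section Frobenius

theorem IsLinearized.map_frob {F : K[X]} (hF : IsLinearized Q F) (s : ℕ) :
    IsLinearized Q (F.map (frob Fq s)) := fun k hk =>
  hF k fun h => hk (by rw [coeff_map, h, map_zero])

theorem map_frob_vecPoly (s : ℕ) (c : Fin n → K) :
    (vecPoly Q c).map (frob Fq s) = vecPoly Q (frobVec Fq s c) := by
  simp only [vecPoly, Polynomial.map_sum, Polynomial.map_mul, Polynomial.map_pow, map_C, map_X]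
  rfl

theorem InSkewIdeal.map_frob {D : Submodule K (Fin n → K)} {F : K[X]} (hF : InSkewIdeal Q D F)
    (s : ℕ) : InSkewIdeal Q (frobCode Fq s D) (F.map (frob Fq s)) := by
  obtain ⟨hl, c, hc, P, hP, he⟩ := inSkewIdeal_iff.mp hF
  refine inSkewIdeal_iff.mpr ⟨hl.map_frob s, _, frobVec_mem_frobCode Fq hc, P.map (frob Fq s),
    hP.map_frob s, ?_⟩
  rw [he, Polynomial.map_add, map_frob_vecPoly, Polynomial.map_comp]
  simp

/-- Supplies the inverse of θ_s as another Frobenius power θ_t. -/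
theorem exists_finrank_dvd_add (s : ℕ) : ∃ t, Module.finrank Fq K ∣ s + t := by
  have hpos : 0 < Module.finrank Fq K := Module.finrank_pos
  refine ⟨s * (Module.finrank Fq K - 1), s, ?_⟩
  obtain ⟨m, hm⟩ := Nat.exists_eq_succ_of_ne_zero hpos.ne'
  rw [hm, Nat.succ_sub_one, Nat.succ_eq_add_one]
  ring

theorem IsSkewGenCheck.frobCode {D : Submodule K (Fin n → K)} {G H : K[X]}
    (h : IsSkewGenCheck Fq r D G H) (s : ℕ) :
    IsSkewGenCheck Fq r (frobCode Fq s D) (G.map (frob Fq s)) (H.map (frob Fq s)) := by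
  refine ⟨h.skewCyclic.frobCode Fq s, h.monic.map _, h.mem.map_frob s, fun F hF hF0 => ?_,
    h.linearized.map_frob s, ?_, ?_⟩
  · obtain ⟨t, ht⟩ := exists_finrank_dvd_add (Fq := Fq) (K := K) s
    have h1 := hF.map_frob t
    rw [frobCode_frobCode, frobCode_of_dvd Fq ht] at h1
    rw [natDegree_map]
    refine (h.minimal _ h1 ?_).trans_eq (natDegree_map _)
    rwa [Ne, Polynomial.map_eq_zero]
  · rw [← Polynomial.map_comp, h.comp_eq]; simp
  · rw [← Polynomial.map_comp, h.comp_eq']; simp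

end Frobenius

end Existence

/-! ### The operations ⊥ and ⊤ -/

section PerpTop

variable {K : Type*} [Field K] {Q n d : ℕ} {F : K[X]}

theorem coeff_sum_range_term (hQ : IsFrobeniusPower K Q) (f : ℕ → K) (k m : ℕ) :
    (∑ i ∈ Finset.range m, C (f i) * X ^ Q ^ i).coeff (Q ^ k) = if k < m then f k else 0 := by
  rw [finsetSum_coeff]
  simp [hQ.coeff_term]

theorem isLinearized_linPerp : IsLinearized Q (linPerp Q F) :=
  IsLinearized.sum _ fun _ _ => isLinearized_term _ _

theorem isLinearized_linTop : IsLinearized Q (linTop Q n F) :=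
  IsLinearized.sum _ fun _ _ => isLinearized_term _ _

theorem coeff_linPerp (hQ : IsFrobeniusPower K Q) (h : F.natDegree = Q ^ d) (k : ℕ) :
    (linPerp Q F).coeff (Q ^ k) =
      if k ≤ d then F.coeff (Q ^ (d - k)) ^ Q ^ k / F.coeff 1 ^ Q ^ d else 0 := by
  rw [linPerp, coeff_sum_range_term hQ, linDegree_eq hQ h]
  simp [linCoeff]

theorem coeff_linTop (hQ : IsFrobeniusPower K Q) (h : F.natDegree = Q ^ d) (k : ℕ) :
    (linTop Q n F).coeff (Q ^ k) =
      if k ≤ d then (F.coeff (Q ^ (d - k)) / F.coeff 1) ^ Q ^ (n - d + k) else 0 := by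
  rw [linTop, coeff_sum_range_term hQ, linDegree_eq hQ h]
  simp [linCoeff]

theorem coeff_linPerp_self (hQ : IsFrobeniusPower K Q) (h : F.natDegree = Q ^ d)
    (h0 : F.coeff 1 ≠ 0) : (linPerp Q F).coeff (Q ^ d) = 1 := by
  rw [coeff_linPerp hQ h, if_pos le_rfl, Nat.sub_self, pow_zero, div_self (pow_ne_zero _ h0)]

theorem natDegree_linPerp (hQ : IsFrobeniusPower K Q) (h : F.natDegree = Q ^ d)
    (h0 : F.coeff 1 ≠ 0) : (linPerp Q F).natDegree = Q ^ d := by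
  refine natDegree_eq_of_le_of_coeff_ne_zero ?_ ?_
  · refine natDegree_le_iff_coeff_eq_zero.mpr fun k hk => ?_
    by_contra hne
    obtain ⟨i, rfl⟩ := isLinearized_linPerp k hne
    rw [coeff_linPerp hQ h, if_neg (not_le.mpr ((Nat.pow_lt_pow_iff_right hQ.1).mp hk))] at hne
    exact hne rfl
  · rw [coeff_linPerp_self hQ h h0]
    exact one_ne_zero

theorem monic_linPerp (hQ : IsFrobeniusPower K Q) (h : F.natDegree = Q ^ d)
    (h0 : F.coeff 1 ≠ 0) : (linPerp Q F).Monic := by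
  rw [Monic, leadingCoeff, natDegree_linPerp hQ h h0, coeff_linPerp_self hQ h h0]

theorem linTop_linPerp (hQ : IsFrobeniusPower K Q) (hn : ∀ a : K, a ^ Q ^ n = a)
    (hF : IsLinearized Q F) (h : F.natDegree = Q ^ d) (hd : d ≤ n) (h0 : F.coeff 1 ≠ 0)
    (hm : F.Monic) : linTop Q n (linPerp Q F) = F := by
  have hlead : F.coeff (Q ^ d) = 1 := by rw [← h]; exact hm
  have hone : (linPerp Q F).coeff 1 = 1 / F.coeff 1 ^ Q ^ d := by
    have := coeff_linPerp hQ h 0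
    simpa [hlead] using this
  have hu := pow_ne_zero (Q ^ d) h0
  refine isLinearized_linTop.ext hF fun k => ?_
  rw [coeff_linTop hQ (natDegree_linPerp hQ h h0), coeff_linPerp hQ h, hone]
  split_ifs with hk hk'
  -- The denominators F_0^(Q^d) cancel, leaving F_k raised to Q^(d-k) by ⊥ and then to Q^(n-d+k) by
  -- ⊤: altogether the power Q^n, the identity.
  · rw [Nat.sub_sub_self hk, div_div_div_cancel_right₀ hu, div_one, ← pow_mul, ← pow_add,
      show d - k + (n - d + k) = n by omega, hn]
  · omega
  · rw [coeff_eq_zero_of_natDegree_lt]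
    rw [h]
    exact Nat.pow_lt_pow_right hQ.1 (not_le.mp hk)

end PerpTop

/-! ### Dual codes -/

section Dual

variable {K : Type*} [Field K] {n : ℕ}

/-- The dual code with respect to the standard bilinear form. -/
def dualCode (D : Submodule K (Fin n → K)) : Submodule K (Fin n → K) where
  carrier := {y | ∀ c ∈ D, c ⬝ᵥ y = 0}
  zero_mem' := fun c _ => dotProduct_zero c
  add_mem' := fun ha hb c hc => by rw [dotProduct_add, ha c hc, hb c hc, add_zero]
  smul_mem' := fun t a ha c hc => by rw [dotProduct_smul, ha c hc, smul_zero]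

theorem dualCode_iSup {ι : Type*} (D : ι → Submodule K (Fin n → K)) :
    dualCode (⨆ i, D i) = ⨅ i, dualCode (D i) := by
  ext y
  rw [Submodule.mem_iInf]
  refine ⟨fun h i c hc => h c (Submodule.mem_iSup_of_mem i hc), fun h c hc => ?_⟩
  exact Submodule.iSup_induction D (motive := fun c => c ⬝ᵥ y = 0) hc (fun i x hx => h i x hx)
    (zero_dotProduct y) fun a b ha hb => by rw [add_dotProduct, ha, hb, add_zero]

/-- A vector outside D is separated from D by a linear functional, which is the dot product with a
word of the dual. -/
theorem dualCode_dualCode (D : Submodule K (Fin n → K)) : dualCode (dualCode D) = D := by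
  refine le_antisymm (fun x hx => ?_) fun c hc y hy => by rw [dotProduct_comm]; exact hy c hc
  by_contra hxD
  obtain ⟨f, hfx, hfD⟩ := Submodule.exists_le_ker_of_notMem hxD
  obtain ⟨y, rfl⟩ := (dotProductEquiv K (Fin n)).surjective f
  refine hfx ?_
  rw [dotProductEquiv_apply_apply]
  refine hx y fun c hc => ?_
  have := hfD hc
  rwa [LinearMap.mem_ker, dotProductEquiv_apply_apply, dotProduct_comm] at this

theorem dualCode_iInf {ι : Type*} (D : ι → Submodule K (Fin n → K)) :
    dualCode (⨅ i, D i) = ⨆ i, dualCode (D i) := by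
  rw [← dualCode_dualCode (⨆ i, dualCode (D i)), dualCode_iSup]
  simp only [dualCode_dualCode]

end Dual

/-! ### The generator polynomial of the dual code -/

section DualGenerator

variable {Fq : Type*} {K : Type*} [Field Fq] [Fintype Fq] [Field K] [Finite K] [Algebra Fq K]
  {n : ℕ} [NeZero n] {r : ℕ}

local notation "Q" => Fintype.card Fq ^ r

theorem frobVec_dotProduct_frobVec (s : ℕ) (a b : Fin n → K) :
    frobVec Fq s a ⬝ᵥ frobVec Fq s b = frob Fq s (a ⬝ᵥ b) := by
  simp only [dotProduct, map_sum, map_mul]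
  rfl

theorem shift_dotProduct_shift (a b : Fin n → K) : shift a ⬝ᵥ shift b = a ⬝ᵥ b := by
  simp only [dotProduct, shift]
  exact Fintype.sum_equiv (Equiv.subRight 1) _ _ fun _ => rfl

theorem shift_injective : Function.Injective (shift : (Fin n → K) → Fin n → K) := fun _ _ h =>
  funext fun i => by simpa [shift] using congrFun h (i + 1)

/-- The skew shift is injective on the finite code, hence onto. Every word of D is thus a skew
shift, and skew shifting both arguments only applies Frobenius to the dot product. -/
theorem IsSkewCyclic.dualCode {D : Submodule K (Fin n → K)} (hD : IsSkewCyclic Fq r D) :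
    IsSkewCyclic Fq r (dualCode D) := by
  intro y hy c hc
  have hinj : Function.Injective (fun c : D => (⟨_, hD c c.2⟩ : D)) := fun a b h =>
    Subtype.ext (shift_injective (frobVec_injective Fq r (Subtype.ext_iff.mp h)))
  obtain ⟨b, hb⟩ := Finite.surjective_of_injective hinj ⟨c, hc⟩
  rw [← show frobVec Fq r (shift (b : Fin n → K)) = c from Subtype.ext_iff.mp hb,
    frobVec_dotProduct_frobVec, shift_dotProduct_shift, hy b b.2, map_zero]

theorem IsSkewGenCheck.natDegrees (hr : 0 < r) {D : Submodule K (Fin n → K)} {G H : K[X]}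
    (h : IsSkewGenCheck Fq r D G H) :
    ∃ g d, G.natDegree = Q ^ g ∧ H.natDegree = Q ^ d ∧ g + d = n := by
  have hQ := isFrobeniusPower_card_pow Fq (K := K) hr
  have hdeg := congrArg natDegree h.comp_eq_pow
  rw [natDegree_comp, natDegree_modulus hQ (NeZero.ne n)] at hdeg
  have hH : H ≠ 0 := by
    rintro rfl
    rw [natDegree_zero, mul_zero] at hdeg
    exact hQ.pow_ne_zero n hdeg.symm
  obtain ⟨g, hg⟩ := h.mem.1.natDegree_eq h.monic.ne_zero
  obtain ⟨d, hd⟩ := h.linearized.natDegree_eq hH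
  refine ⟨g, d, hg, hd, ?_⟩
  rwa [hg, hd, ← pow_add, hQ.pow_inj] at hdeg

theorem coeff_one_comp (hr : 0 < r) {A B : K[X]} (hA : IsLinearized Q A) (hB : IsLinearized Q B) :
    (A.comp B).coeff 1 = A.coeff 1 * B.coeff 1 := by
  have hQ := isFrobeniusPower_card_pow Fq (K := K) hr
  refine hA.induction (motive := fun A => (A.comp B).coeff 1 = A.coeff 1 * B.coeff 1) ?_ ?_ ?_
  · simp
  · intro F G _ _ h h'; rw [add_comp, coeff_add, h, h', coeff_add, add_mul]
  · intro a i
    have h1 := hQ.coeff_term a i 0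
    have h2 := hB.coeff_pow hQ i 0
    rw [pow_zero] at h1 h2
    rw [mul_comp, C_comp, X_pow_comp, coeff_C_mul, h1, h2]
    rcases Nat.eq_zero_or_pos i with rfl | hi
    · simp
    · simp [hi.ne', hi.ne]

theorem IsSkewGenCheck.coeff_one_ne_zero (hr : 0 < r) {D : Submodule K (Fin n → K)} {G H : K[X]}
    (h : IsSkewGenCheck Fq r D G H) : G.coeff 1 ≠ 0 ∧ H.coeff 1 ≠ 0 := by
  have hQ := isFrobeniusPower_card_pow Fq (K := K) hr
  rw [← mul_ne_zero_iff, ← coeff_one_comp hr h.mem.1 h.linearized, h.comp_eq_pow]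
  have := coeff_modulus (n := n) (K := K) hQ 0
  rw [pow_zero] at this
  simp [this, (NeZero.ne n).symm]

theorem IsSkewGenCheck.monic_check (hr : 0 < r) {D : Submodule K (Fin n → K)} {G H : K[X]}
    (h : IsSkewGenCheck Fq r D G H) : H.Monic := by
  have hQ := isFrobeniusPower_card_pow Fq (K := K) hr
  have hG := h.mem.1.natDegree_ne_zero hQ h.monic.ne_zero
  have := congrArg leadingCoeff h.comp_eq_pow'
  rwa [leadingCoeff_comp hG, h.monic.leadingCoeff, one_pow, mul_one,
    (monic_modulus hQ (NeZero.ne n)).leadingCoeff] at this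

theorem IsSkewGenCheck.linTop_linPerp (hr : 0 < r) (hdvd : Module.finrank Fq K ∣ r * n)
    {D : Submodule K (Fin n → K)} {G H : K[X]} (h : IsSkewGenCheck Fq r D G H) :
    linTop Q n (linPerp Q H) = H := by
  have hQ := isFrobeniusPower_card_pow Fq (K := K) hr
  obtain ⟨g, d, -, hd, hn⟩ := h.natDegrees hr
  refine SkewCyclic.linTop_linPerp hQ (fun a => ?_) h.linearized hd (by omega)
    (h.coeff_one_ne_zero hr).2 (h.monic_check hr)
  rw [← pow_mul]
  exact pow_card_pow_of_dvd Fq hdvd a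

/-- P ∘ (x^(Q^n) - x) has only terms of degree at least Q^n and terms of degree below Q^d, leaving a
gap at Q^d. -/
theorem coeff_comp_modulus_eq_zero (hQ : IsFrobeniusPower K Q) {P : K[X]} (hP : IsLinearized Q P)
    {d : ℕ} (hd : d < n) (hdeg : P.natDegree < Q ^ d) :
    (P.comp (X ^ Q ^ n - X)).coeff (Q ^ d) = 0 := by
  rw [hP.comp_sub hQ, comp_X, coeff_sub, coeff_eq_zero_of_natDegree_lt hdeg, sub_zero]
  refine hP.induction (motive := fun P => (P.comp (X ^ Q ^ n)).coeff (Q ^ d) = 0) ?_ ?_ ?_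
  · simp
  · intro F G _ _ h h'; rw [add_comp, coeff_add, h, h', add_zero]
  · intro a i
    rw [mul_comp, C_comp, X_pow_comp, ← pow_mul (X : K[X]), ← pow_add, hQ.coeff_term,
      if_neg (by omega)]

/-- Up to the factor H_0^(Q^d), the dot product of c with the coefficients of H^⊥ is the coefficient
at Q^d of c(x) ∘ H. If c(x) = P ∘ G, this composite is P ∘ (x^(Q^n) - x), which vanishes there. -/
theorem IsSkewGenCheck.linPerp_mem (hr : 0 < r) {D : Submodule K (Fin n → K)} {G H : K[X]}
    (h : IsSkewGenCheck Fq r D G H) : InSkewIdeal Q (SkewCyclic.dualCode D) (linPerp Q H) := by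
  have hQ := isFrobeniusPower_card_pow Fq (K := K) hr
  have hn0 : n ≠ 0 := NeZero.ne n
  obtain ⟨g, d, hg, hd, hn⟩ := h.natDegrees hr
  have h0 := (h.coeff_one_ne_zero hr).2
  -- For g = 0 the check polynomial is the modulus itself, of degree too large to be a word; then
  -- H^⊥ = H, which represents the zero word.
  rcases Nat.eq_zero_or_pos g with rfl | hgpos
  · obtain rfl : d = n := by omega
    rw [pow_zero] at hg
    have hGX : G = X := by
      have h1 := h.mem.1.eq_C_mul_X hQ hg
      have h2 : G.coeff 1 = 1 := by rw [← hg]; exact h.monic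
      rwa [h2, C_1, one_mul] at h1
    have hH : H = X ^ Q ^ d - X := by rw [← h.comp_eq_pow, hGX, X_comp]
    have hperp : linPerp Q H = X ^ Q ^ d - X := by
      refine isLinearized_linPerp.ext isLinearized_modulus fun k => ?_
      have hc := fun i => coeff_modulus (n := d) (K := K) hQ i
      have hc1 := hc 0
      rw [pow_zero] at hc1
      have hneg : ∀ i, (-1 : K) ^ Q ^ i = -1 := fun i => by
        have := hQ.add_pow_field i (1 : K) (-1)
        rw [add_neg_cancel, zero_pow (hQ.pow_ne_zero i), one_pow] at this
        exact (eq_neg_of_add_eq_zero_right this.symm)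
      rw [coeff_linPerp hQ hd, hH, hc, hc, hc1]
      rcases Nat.eq_zero_or_pos k with rfl | hk
      · simp [hn0, hn0.symm, hneg]
      · rcases lt_trichotomy k d with hlt | rfl | hlt
        · simp [hlt.le, hlt.ne, hk.ne', hn0.symm, (show d - k ≠ d by omega),
            (show d - k ≠ 0 by omega), zero_pow (hQ.pow_ne_zero k)]
        · simp [hn0, hn0.symm, hneg]
        · simp [hlt.ne', hlt.not_ge, hk.ne']
    rw [hperp]
    exact inSkewIdeal_modulus _
  · have hdn : d < n := by omega
    have hlt : (linPerp Q H).natDegree < Q ^ n := by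
      rw [natDegree_linPerp hQ hd h0]
      exact Nat.pow_lt_pow_right hQ.1 hdn
    rw [exists_vecPoly hQ isLinearized_linPerp hlt]
    refine inSkewIdeal_vecPoly fun c hc => ?_
    obtain ⟨P, hP, he⟩ := (h.generator.inSkewIdeal_iff hr h.skewCyclic
      (isLinearized_vecPoly c)).mp (inSkewIdeal_vecPoly hc)
    have hPdeg : P.natDegree < Q ^ d := by
      have h1 := natDegree_vecPoly_lt hQ hn0 c
      rw [he, natDegree_comp, hg, ← hn, add_comm, pow_add] at h1
      exact lt_of_mul_lt_mul_right h1 (Nat.zero_le _)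
    have hzero := coeff_comp_modulus_eq_zero hQ hP hdn hPdeg
    rw [← h.comp_eq_pow, ← comp_assoc, ← he, vecPoly, Polynomial.sum_comp,
      finsetSum_coeff] at hzero
    have hdot : ∀ i : Fin n, c i * (linPerp Q H).coeff (Q ^ (i : ℕ)) =
        ((C (c i) * X ^ Q ^ (i : ℕ)).comp H).coeff (Q ^ d) / H.coeff 1 ^ Q ^ d := by
      intro i
      rw [mul_comp, C_comp, X_pow_comp, coeff_C_mul, h.linearized.coeff_pow hQ,
        coeff_linPerp hQ hd]
      split_ifs
      · rw [mul_div_assoc]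
      · simp
    rw [dotProduct, Finset.sum_congr rfl fun i _ => hdot i, ← Finset.sum_div, hzero, zero_div]

/-- For minimality, suppose F in the dual ideal has degree Q^k with k < d. Its word is supported on
coordinates up to k, and that of G^(Q^k), a word of D, on coordinates from k on. Their dot product
is the single nonzero term at k, a contradiction. -/
theorem IsSkewGenCheck.linPerp_generator (hr : 0 < r) {D : Submodule K (Fin n → K)} {G H : K[X]}
    (h : IsSkewGenCheck Fq r D G H) :
    IsSkewGenerator r Fq (SkewCyclic.dualCode D) (linPerp Q H) := by
  have hQ := isFrobeniusPower_card_pow Fq (K := K) hr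
  have hn0 : n ≠ 0 := NeZero.ne n
  obtain ⟨g, d, hg, hd, hn⟩ := h.natDegrees hr
  obtain ⟨hG0, hH0⟩ := h.coeff_one_ne_zero hr
  refine ⟨monic_linPerp hQ hd hH0, h.linPerp_mem hr, fun F hF hF0 => ?_⟩
  rw [natDegree_linPerp hQ hd hH0]
  by_contra hlt
  rw [not_le] at hlt
  obtain ⟨k, hk⟩ := hF.1.natDegree_eq hF0
  rw [hk, Nat.pow_lt_pow_iff_right hQ.1] at hlt
  obtain ⟨y, hy, hFy⟩ := hF.exists_of_natDegree_lt hQ hn0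
    (by rw [hk]; exact Nat.pow_lt_pow_right hQ.1 (by omega))
  have hGk := h.mem.comp hr h.skewCyclic (isLinearized_X_pow k)
  rw [X_pow_comp] at hGk
  obtain ⟨c, hc, hGc⟩ := hGk.exists_of_natDegree_lt hQ hn0 (by
    rw [natDegree_pow, hg, ← pow_add]
    exact Nat.pow_lt_pow_right hQ.1 (by omega))
  have hkn : k < n := by omega
  have hcoef : ∀ i : Fin n, c i = if k ≤ i then G.coeff (Q ^ ((i : ℕ) - k)) ^ Q ^ k else 0 :=
    fun i => by rw [← coeff_vecPoly_fin hQ c i, ← hGc, h.mem.1.coeff_pow hQ]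
  have hy0 : ∀ i : Fin n, k < i → y i = 0 := fun i hi => by
    rw [← coeff_vecPoly_fin hQ y i, ← hFy]
    exact coeff_eq_zero_of_natDegree_lt (by rw [hk]; exact Nat.pow_lt_pow_right hQ.1 hi)
  have hyk : y ⟨k, hkn⟩ ≠ 0 := by
    have h1 := leadingCoeff_ne_zero.mpr hF0
    rw [leadingCoeff, hk, hFy] at h1
    rwa [← coeff_vecPoly_fin hQ y ⟨k, hkn⟩]
  have hdot := hy c hc
  rw [dotProduct, Finset.sum_eq_single ⟨k, hkn⟩] at hdot
  · refine mul_ne_zero ?_ hyk hdot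
    rw [hcoef, if_pos le_rfl]
    simpa using hG0
  · intro i _ hi
    rcases lt_trichotomy (i : ℕ) k with hlt' | heq | hgt
    · rw [hcoef, if_neg (not_le.mpr hlt'), zero_mul]
    · exact absurd (Fin.ext heq) hi
    · rw [hy0 i hgt, mul_zero]
  · simp

end DualGenerator

/-! ### Galois stability of closure and interior -/

section Galois

variable (Fq : Type*) {K : Type*} [Field Fq] [Fintype Fq] [Field K] [Finite K] [Algebra Fq K]
  {n : ℕ}

/-- Stability under all the maps `θ_s`. -/
def IsGaloisStable (D : Submodule K (Fin n → K)) : Prop :=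
  ∀ s : ℕ, ∀ c ∈ D, frobVec Fq s c ∈ D

variable {Fq}

theorem IsGaloisStable.frobCode_eq {D : Submodule K (Fin n → K)} (h : IsGaloisStable Fq D)
    (s : ℕ) : frobCode Fq s D = D := by
  refine le_antisymm ?_ fun c hc => ?_
  · rintro _ ⟨c, hc, rfl⟩
    exact h s c hc
  · obtain ⟨t, ht⟩ := exists_finrank_dvd_add (Fq := Fq) (K := K) s
    exact ⟨_, h t c hc, by rw [frobVec_frobVec, add_comm t s, frobVec_of_dvd Fq ht]⟩

/-- Galois stability allows θ_r to be undone after the skew shift. -/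
theorem IsGaloisStable.isCyclicCode [NeZero n] {r : ℕ} {D : Submodule K (Fin n → K)}
    (h : IsGaloisStable Fq D) (hD : IsSkewCyclic Fq r D) : IsCyclicCode D := fun c hc => by
  obtain ⟨t, ht⟩ := exists_finrank_dvd_add (Fq := Fq) (K := K) r
  have := h t _ (hD c hc)
  rwa [frobVec_frobVec, frobVec_of_dvd Fq ht] at this

theorem frobCode_mod (s : ℕ) (D : Submodule K (Fin n → K)) :
    frobCode Fq (s % Module.finrank Fq K) D = frobCode Fq s D := by
  conv_rhs => rw [← Nat.mod_add_div s (Module.finrank Fq K), ← frobCode_frobCode,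
    frobCode_of_dvd Fq (dvd_mul_right _ _)]

theorem frobCode_le_galoisClosure (s : ℕ) (D : Submodule K (Fin n → K)) :
    frobCode Fq s D ≤ galoisClosure Fq D := by
  rw [← frobCode_mod]
  exact le_iSup (fun i : Fin (Module.finrank Fq K) => frobCode Fq i D)
    ⟨s % Module.finrank Fq K, Nat.mod_lt _ Module.finrank_pos⟩

theorem galoisInterior_le_frobCode (s : ℕ) (D : Submodule K (Fin n → K)) :
    galoisInterior Fq D ≤ frobCode Fq s D := by
  rw [← frobCode_mod]
  exact iInf_le (fun i : Fin (Module.finrank Fq K) => frobCode Fq i D)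
    ⟨s % Module.finrank Fq K, Nat.mod_lt _ Module.finrank_pos⟩

theorem isGaloisStable_galoisClosure (D : Submodule K (Fin n → K)) :
    IsGaloisStable Fq (galoisClosure Fq D) := fun s c hc => by
  refine Submodule.iSup_induction (fun i : Fin (Module.finrank Fq K) => frobCode Fq i D)
    (motive := fun c => frobVec Fq s c ∈ galoisClosure Fq D) hc (fun i x hx => ?_) ?_ ?_
  · refine frobCode_le_galoisClosure (i + s) D ?_
    rw [← frobCode_frobCode]
    exact frobVec_mem_frobCode Fq hx
  · convert Submodule.zero_mem _
    exact funext fun i => map_zero (frob Fq s : K →+* K)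
  · intro x y hx hy
    rw [frobVec_add]
    exact Submodule.add_mem _ hx hy

theorem isGaloisStable_galoisInterior (D : Submodule K (Fin n → K)) :
    IsGaloisStable Fq (galoisInterior Fq D) := fun s c hc => by
  refine (Submodule.mem_iInf _).mpr fun i => ?_
  obtain ⟨t, ht⟩ := exists_finrank_dvd_add (Fq := Fq) (K := K) s
  -- The index i + t is chosen so that θ_s lands in C^{[i+t+s]} = C^{[i]}.
  have hmem := frobVec_mem_frobCode Fq (s := s) (galoisInterior_le_frobCode (i + t) D hc)
  rwa [frobCode_frobCode, add_assoc, ← frobCode_frobCode, add_comm t s,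
    frobCode_of_dvd Fq ht] at hmem

end Galois

/-! ### Comparison with conventional cyclic codes -/

section Conventional

variable {Fq : Type*} {K : Type*} [Field Fq] [Fintype Fq] [Field K] [Finite K] [Algebra Fq K]
  {n : ℕ} [NeZero n] {r : ℕ}

local notation "Q" => Fintype.card Fq ^ r

theorem linearize_X_pow_sub_one (hQ : IsFrobeniusPower K Q) :
    linearize Q (X ^ n - 1 : K[X]) = X ^ Q ^ n - X := by
  refine (isLinearized_linearize _).ext isLinearized_modulus fun i => ?_
  rw [coeff_linearize hQ, coeff_modulus hQ, coeff_sub, coeff_X_pow, coeff_one]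

theorem linearize_add_mul (hQ : IsFrobeniusPower K Q) (c : Fin n → K) (p : K[X]) :
    linearize Q (∑ i : Fin n, C (c i) * X ^ (i : ℕ) + p * (X ^ n - 1)) =
      vecPoly Q c + (linearize Q p).comp (X ^ Q ^ n - X) := by
  have hfix : ∀ i, (X ^ n - 1 : K[X]).coeff i ^ Q = (X ^ n - 1 : K[X]).coeff i := by
    intro i
    have hmap : (X ^ n - 1 : K[X]).map (frob Fq r) = X ^ n - 1 := by simp
    conv_rhs => rw [← hmap, coeff_map]
    rfl
  rw [← linearize_X_pow_sub_one hQ, ← linearize_mul hQ p hfix]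
  refine (isLinearized_linearize _).ext
    ((isLinearized_vecPoly _).add (isLinearized_linearize _)) fun k => ?_
  rw [coeff_add, coeff_linearize hQ, coeff_linearize hQ, coeff_add, vecPoly, finsetSum_coeff,
    finsetSum_coeff]
  simp only [hQ.coeff_term, coeff_C_mul_X_pow]

theorem inIdeal_iff_inSkewIdeal (hQ : IsFrobeniusPower K Q) {D : Submodule K (Fin n → K)}
    {f : K[X]} : InIdeal D f ↔ InSkewIdeal Q D (linearize Q f) := by
  rw [inSkewIdeal_iff]
  constructor
  · rintro ⟨c, hc, p, rfl⟩
    exact ⟨isLinearized_linearize _, c, hc, _, isLinearized_linearize p,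
      linearize_add_mul hQ c p⟩
  · rintro ⟨-, c, hc, P, hP, he⟩
    obtain ⟨p, rfl⟩ := hP.exists_linearize hQ
    rw [← linearize_add_mul hQ] at he
    exact ⟨c, hc, p, linearize_injective hQ he⟩

theorem IsGenCheck.linearize (hQ : IsFrobeniusPower K Q) {D : Submodule K (Fin n → K)}
    {g h : K[X]} (hg : IsGenCheck D g h) : IsSkewGenerator r Fq D (linearize Q g) := by
  refine ⟨(monic_linearize hQ).mpr hg.monic, (inIdeal_iff_inSkewIdeal hQ).mp hg.mem,
    fun F hF hF0 => ?_⟩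
  obtain ⟨f, rfl⟩ := hF.1.exists_linearize hQ
  have hf : f ≠ 0 := by
    rintro rfl
    exact hF0 (by simp [SkewCyclic.linearize])
  rw [natDegree_linearize hQ hg.monic.ne_zero, natDegree_linearize hQ hf]
  exact Nat.pow_le_pow_right hQ.pos (hg.minimal f ((inIdeal_iff_inSkewIdeal hQ).mpr hF) hf)

/-- For a Galois stable code, the conventional polynomials linearize to the skew ones. -/
theorem IsSkewGenCheck.existsUnique_isGenCheck (hr : 0 < r) {D : Submodule K (Fin n → K)}
    {G H : K[X]} (h : IsSkewGenCheck Fq r D G H) (hs : IsGaloisStable Fq D) :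
    (∃! p : K[X] × K[X], IsGenCheck D p.1 p.2) ∧ ∀ g k : K[X], IsGenCheck D g k →
      G = linearize Q g ∧ H = linearize Q k := by
  have hQ := isFrobeniusPower_card_pow Fq (K := K) hr
  obtain ⟨g, rfl⟩ := h.mem.1.exists_linearize hQ
  obtain ⟨k, rfl⟩ := h.linearized.exists_linearize hQ
  -- θ_r maps the pair to a generator and check pair of the same code, so uniqueness forces the
  -- coefficients of H to be fixed by the power Q.
  have hfrob := h.frobCode r
  rw [hs.frobCode_eq] at hfrob
  have hmap := (h.unique hr hfrob).2
  have hfix : ∀ i, k.coeff i ^ Q = k.coeff i := fun i => by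
    have h1 := congrArg (fun F => F.coeff (Q ^ i)) hmap
    simp only [coeff_map, coeff_linearize hQ] at h1
    exact h1.symm
  have hmul : g * k = X ^ n - 1 := by
    refine linearize_injective hQ ?_
    rw [linearize_mul hQ g hfix, linearize_X_pow_sub_one hQ, h.comp_eq_pow]
  have hgk : IsGenCheck D g k := by
    refine ⟨hs.isCyclicCode h.skewCyclic, (monic_linearize hQ).mp h.monic,
      (inIdeal_iff_inSkewIdeal hQ).mpr h.mem, fun f hf hf0 => ?_, hmul⟩
    have h0 : linearize Q f ≠ 0 := fun he =>
      hf0 (linearize_injective hQ (he.trans (by simp [SkewCyclic.linearize])))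
    have hle := h.minimal _ ((inIdeal_iff_inSkewIdeal hQ).mp hf) h0
    rw [natDegree_linearize hQ ((monic_linearize hQ).mp h.monic).ne_zero,
      natDegree_linearize hQ hf0] at hle
    exact (Nat.pow_le_pow_iff_right hQ.1).mp hle
  have huniq : ∀ g' k' : K[X], IsGenCheck D g' k' → g' = g ∧ k' = k := by
    intro g' k' h'
    obtain rfl := linearize_injective hQ ((h'.linearize hQ).unique h.generator)
    exact ⟨rfl, mul_left_cancel₀ h'.monic.ne_zero (h'.mul_eq.trans hmul.symm)⟩
  refine ⟨⟨(g, k), hgk, fun p hp => Prod.ext (huniq _ _ hp).1 (huniq _ _ hp).2⟩,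
    fun g' k' h' => ?_⟩
  obtain ⟨rfl, rfl⟩ := huniq g' k' h'
  exact ⟨rfl, rfl⟩


/-! ### Polynomials of the Galois closure and interior -/

theorem IsSkewGenCheck.galoisClosure (hr : 0 < r) (hdvd : Module.finrank Fq K ∣ r * n)
    {D : Submodule K (Fin n → K)} {G H : K[X]} (h : IsSkewGenCheck Fq r D G H) :
    IsSkewGenCheck Fq r (galoisClosure Fq D) (upperStar Fq r G) (lowerZero Fq r n H) := by
  have hQ := isFrobeniusPower_card_pow Fq (K := K) hr
  have : NeZero (Module.finrank Fq K) := ⟨Module.finrank_pos.ne'⟩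
  have hcyc := fun i : Fin (Module.finrank Fq K) => h.skewCyclic.frobCode Fq i
  obtain ⟨A, B, hAB⟩ := exists_isSkewGenCheck hr hdvd (IsSkewCyclic.iSup Fq hcyc)
  have hA : upperStar Fq r G = A := IsRightGcd.rightGcd_eq hQ
    (isRightGcd_of_iSup hr hcyc (fun i => (h.frobCode i).generator) hAB.generator)
  have hperp := hAB.linPerp_generator hr
  -- B^⊥ now generates the intersection of the duals of the C^{[i]}, so it is the lcm of their
  -- generators θ_i(H)^⊥.
  rw [dualCode_iSup] at hperp
  have hB : lowerZero Fq r n H = B := by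
    rw [lowerZero, IsRightLcm.rightLcm_eq hQ (isRightLcm_of_iInf hr
      (fun i => (hcyc i).dualCode) (fun i => (h.frobCode i).linPerp_generator hr) hperp),
      hAB.linTop_linPerp hr hdvd]
  rw [hA, hB]
  exact hAB

theorem IsSkewGenCheck.galoisInterior (hr : 0 < r) (hdvd : Module.finrank Fq K ∣ r * n)
    {D : Submodule K (Fin n → K)} {G H : K[X]} (h : IsSkewGenCheck Fq r D G H) :
    IsSkewGenCheck Fq r (galoisInterior Fq D) (upperZero Fq r G) (lowerStar Fq r n H) := by
  have hQ := isFrobeniusPower_card_pow Fq (K := K) hr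
  have : NeZero (Module.finrank Fq K) := ⟨Module.finrank_pos.ne'⟩
  have hcyc := fun i : Fin (Module.finrank Fq K) => h.skewCyclic.frobCode Fq i
  obtain ⟨A, B, hAB⟩ := exists_isSkewGenCheck hr hdvd (IsSkewCyclic.iInf Fq hcyc)
  have hA : upperZero Fq r G = A := IsRightLcm.rightLcm_eq hQ
    (isRightLcm_of_iInf hr hcyc (fun i => (h.frobCode i).generator) hAB.generator)
  have hperp := hAB.linPerp_generator hr
  -- Here B^⊥ generates the sum of the duals, hence is the gcd of the θ_i(H)^⊥.
  rw [dualCode_iInf] at hperp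
  have hB : lowerStar Fq r n H = B := by
    rw [lowerStar, IsRightGcd.rightGcd_eq hQ (isRightGcd_of_iSup hr
      (fun i => (hcyc i).dualCode) (fun i => (h.frobCode i).linPerp_generator hr) hperp),
      hAB.linTop_linPerp hr hdvd]
  rw [hA, hB]
  exact hAB

end Conventional

end SkewCyclic

theorem mainTheorem11 (Fq K : Type*) [Field Fq] [Fintype Fq] [Field K] [Finite K] [Algebra Fq K]
    (n r : ℕ) [NeZero n] (hr : 0 < r) (hdvd : Module.finrank Fq K ∣ r * n)
    (C : Submodule K (Fin n → K)) (hC : IsSkewCyclic Fq r C) :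
    (∃! P : K[X] × K[X], IsSkewGenCheck Fq r C P.1 P.2) ∧
    (∃! p : K[X] × K[X], IsGenCheck (galoisClosure Fq C) p.1 p.2) ∧
    (∃! p : K[X] × K[X], IsGenCheck (galoisInterior Fq C) p.1 p.2) ∧
    ∀ G H : K[X], IsSkewGenCheck Fq r C G H →
      IsSkewGenCheck Fq r (galoisClosure Fq C) (upperStar Fq r G) (lowerZero Fq r n H) ∧
      IsSkewGenCheck Fq r (galoisInterior Fq C) (upperZero Fq r G) (lowerStar Fq r n H) ∧
      (∀ gStar hZero : K[X], IsGenCheck (galoisClosure Fq C) gStar hZero →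
        upperStar Fq r G = linearize (Fintype.card Fq ^ r) gStar ∧
        lowerZero Fq r n H = linearize (Fintype.card Fq ^ r) hZero) ∧
      (∀ gZero hStar : K[X], IsGenCheck (galoisInterior Fq C) gZero hStar →
        upperZero Fq r G = linearize (Fintype.card Fq ^ r) gZero ∧
        lowerStar Fq r n H = linearize (Fintype.card Fq ^ r) hStar) := by
  obtain ⟨G₀, H₀, h₀⟩ := exists_isSkewGenCheck hr hdvd hC
  have hclosure := isGaloisStable_galoisClosure (Fq := Fq) C
  have hinterior := isGaloisStable_galoisInterior (Fq := Fq) C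
  refine ⟨⟨(G₀, H₀), h₀, fun P hP => Prod.ext (hP.unique hr h₀).1 (hP.unique hr h₀).2⟩,
    ((h₀.galoisClosure hr hdvd).existsUnique_isGenCheck hr hclosure).1,
    ((h₀.galoisInterior hr hdvd).existsUnique_isGenCheck hr hinterior).1, fun G H h => ?_⟩
  have h1 := h.galoisClosure hr hdvd
  have h2 := h.galoisInterior hr hdvd
  exact ⟨h1, h2, (h1.existsUnique_isGenCheck hr hclosure).2,
    (h2.existsUnique_isGenCheck hr hinterior).2⟩
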